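/- Let $R$ be a commutative noetherian complete local Gorenstein ring of Krull dimension $d\ge 0$, and let $A$ be a module-finite (not necessarily commutative) $R$-algebra. Modules are finitely generated right modules unless otherwise stated. An $R$-module $M$ is called Cohen--Macaulay if $M=0$ or $\dim M=\operatorname{depth} M=d$; $\operatorname{CM}(A)$ is the category of $A$-modules that are Cohen--Macaulay over $R$. For a category $\mathcal C$ of $A$-modules, $\underline{\mathcal C}$ denotes the quotient of $\mathcal C$ by the maps that factor through projective modules. Assume that $A$ is an isolated singularity, that is, $A\in\operatorname{CM}(A)$ and $\underline{\operatorname{Hom}}_A(X,Y)$ has finite length over $R$ for all $X,Y\in\operatorname{CM}(A)$. Write $\Omega M$ for the kernel of a projective cover of $M$ (projective covers exist over $A$, on both sides), and assume that $A$ is $2d$-periodic, that is, the functor $\Omega^{2d}:\underline{\operatorname{CM}}(A)\to\underline{\operatorname{CM}}(A)$ is isomorphic to the identity functor. Write $(-)^*=\operatorname{Hom}_A(-,A)$, $D_d=\operatorname{Hom}_R(-,R)$ and $\nu=D_d\circ(-)^*$. For a module $M$ with minimal projective presentation $P_1\xrightarrow{g}P_0\to M\to 0$ let $\operatorname{Tr}(M)=\operatorname{coker}(g^*:P_0^*\to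 P_1^*)$, a left $A$-module, and put $\operatorname{Tr}_d(M)=\Omega^d\operatorname{Tr}(M)$ and $\tau(M)=D_d\operatorname{Tr}_d(M)$. A module $Z$ is reflexive if the evaluation map $Z\to Z^{**}$ is an isomorphism. Let $X\in\operatorname{CM}(A)$ be indecomposable and non-projective. Then the following are equivalent: 1. $\operatorname{Ext}_A^{d+1}(X,A)=\operatorname{Ext}_A^{d+2}(X,A)=0$; 2. $\operatorname{Tr}_d(X)$ is reflexive; 3. $\tau(X)\cong\nu\,\Omega^{d+2}(X)$ as right $A$-modules. -/

import Mathlib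

open CategoryTheory MulOpposite

universe u

noncomputable section

namespace CMOrder

/-! ### Commutative algebra over the base ring -/

/-- A (noetherian) local ring is Gorenstein if it has finite injective dimension as a module over
itself. -/
def IsGorensteinLocal (R : Type u) [CommRing R] [IsLocalRing R] : Prop :=
  injectiveDimension (ModuleCat.of R R) ≠ ⊤

/-- The depth of a module over a local ring: the supremum of the lengths of the `M`-regular
sequences contained in the maximal ideal. -/
def depth (R : Type u) [CommRing R] [IsLocalRing R] (M : Type u) [AddCommGroup M] [Module R M] :
    ℕ∞ :=
  ⨆ rs : {rs : List R // (∀ r ∈ rs, r ∈ IsLocalRing.maximalIdeal R) ∧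
    RingTheory.Sequence.IsRegular M rs}, (rs.1.length : ℕ∞)

/-- An `R`-module `M` is (maximal) Cohen-Macaulay if `M = 0` or
`dim M = depth M = dim R`. -/
def IsCohenMacaulay (R : Type u) [CommRing R] [IsLocalRing R] (M : Type u) [AddCommGroup M]
    [Module R M] : Prop :=
  Subsingleton M ∨
    (Module.supportDim R M = ringKrullDim R ∧ (depth R M : WithBot ℕ∞) = ringKrullDim R)

/-! ### Maps factoring through projectives, isolated singularities -/

section Factor

variable (B : Type u) [Ring B] {M N : Type u} [AddCommGroup M] [Module B M] [AddCommGroup N]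
  [Module B N]

/-- The linear map `f` factors through a finitely generated projective module. -/
def FactorsThroughProjective (f : M →ₗ[B] N) : Prop :=
  ∃ P : FGModuleCat.{u} B, Module.Projective B P ∧
    ∃ (a : M →ₗ[B] P) (b : P →ₗ[B] N), f = b ∘ₗ a

variable {B}

lemma FactorsThroughProjective.zero : FactorsThroughProjective B (0 : M →ₗ[B] N) :=
  ⟨FGModuleCat.of B PUnit.{u + 1}, inferInstanceAs (Module.Projective B PUnit.{u + 1}), 0, 0, by simp⟩

lemma FactorsThroughProjective.add {f g : M →ₗ[B] N} (hf : FactorsThroughProjective B f)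
    (hg : FactorsThroughProjective B g) : FactorsThroughProjective B (f + g) := by
  obtain ⟨P, hP, a, b, rfl⟩ := hf
  obtain ⟨Q, hQ, a', b', rfl⟩ := hg
  refine ⟨FGModuleCat.of B (P × Q), inferInstanceAs (Module.Projective B (P × Q)), a.prod a',
    b.coprod b', ?_⟩
  ext x
  simp

lemma FactorsThroughProjective.neg {f : M →ₗ[B] N} (hf : FactorsThroughProjective B f) :
    FactorsThroughProjective B (-f) := by
  obtain ⟨P, hP, a, b, rfl⟩ := hf
  exact ⟨P, hP, a, -b, by ext; simp⟩

variable {L : Type u} [AddCommGroup L] [Module B L]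

lemma FactorsThroughProjective.comp_left {f : M →ₗ[B] N} (hf : FactorsThroughProjective B f)
    (g : N →ₗ[B] L) : FactorsThroughProjective B (g ∘ₗ f) := by
  obtain ⟨P, hP, a, b, rfl⟩ := hf
  exact ⟨P, hP, a, g ∘ₗ b, by rw [LinearMap.comp_assoc]⟩

lemma FactorsThroughProjective.comp_right {f : M →ₗ[B] N} (hf : FactorsThroughProjective B f)
    (g : L →ₗ[B] M) : FactorsThroughProjective B (f ∘ₗ g) := by
  obtain ⟨P, hP, a, b, rfl⟩ := hf
  exact ⟨P, hP, a ∘ₗ g, b, by rw [LinearMap.comp_assoc]⟩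

end Factor

/-- The `R`-submodule of `Hom_B(M, N)` of the maps that factor through a projective module. -/
def projHoms (R B M N : Type u) [CommRing R] [Ring B] [Algebra R B]
    [AddCommGroup M] [Module B M]
    [AddCommGroup N] [Module R N] [Module B N] [IsScalarTower R B N] :
    Submodule R (M →ₗ[B] N) where
  carrier := {f | FactorsThroughProjective B f}
  zero_mem' := FactorsThroughProjective.zero
  add_mem' := FactorsThroughProjective.add
  smul_mem' := by
    rintro r f ⟨P, hP, a, b, rfl⟩
    exact ⟨P, hP, a, r • b, by ext; simp⟩

/-- The stable Hom-space `Hom_B(M, N)` modulo the maps factoring through projectives, as an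
`R`-module. -/
abbrev StableHom (R B M N : Type u) [CommRing R] [Ring B] [Algebra R B]
    [AddCommGroup M] [Module B M]
    [AddCommGroup N] [Module R N] [Module B N] [IsScalarTower R B N] : Type u :=
  (M →ₗ[B] N) ⧸ projHoms R B M N

/-- An `R`-algebra `A` is an isolated singularity if it is an `R`-order (that is, `A` is
Cohen-Macaulay over `R`) and the stable Hom-spaces between (finitely generated, right)
Cohen-Macaulay `A`-modules have finite length over `R`.
Right `A`-modules are modules over `Aᵐᵒᵖ`. -/
structure IsIsolatedSingularity (R A : Type u) [CommRing R] [IsLocalRing R] [Ring A]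
    [Algebra R A] : Prop where
  isOrder : IsCohenMacaulay R A
  finiteLength : ∀ (X Y : Type u)
    [AddCommGroup X] [Module R X] [Module Aᵐᵒᵖ X] [IsScalarTower R Aᵐᵒᵖ X]
    [Module.Finite Aᵐᵒᵖ X]
    [AddCommGroup Y] [Module R Y] [Module Aᵐᵒᵖ Y] [IsScalarTower R Aᵐᵒᵖ Y]
    [Module.Finite Aᵐᵒᵖ Y],
    IsCohenMacaulay R X → IsCohenMacaulay R Y → IsFiniteLength R (StableHom R Aᵐᵒᵖ X Y)

/-- A nonzero module that is not the direct sum of two nonzero submodules. -/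
def IsIndecomposable (B M : Type u) [Ring B] [AddCommGroup M] [Module B M] : Prop :=
  Nontrivial M ∧ ∀ U V : Submodule B M, IsCompl U V → U = ⊥ ∨ V = ⊥

/-- The module `M` over an `R`-algebra `B` is Cohen-Macaulay as an `R`-module. -/
def IsCMObj (R : Type u) [CommRing R] [IsLocalRing R] {B : Type u} [Ring B] [Algebra R B]
    (M : FGModuleCat.{u} B) : Prop :=
  letI : Module R M := Module.restrictScalars R B M
  IsCohenMacaulay R M

/-! ### Projective covers and syzygies -/

section Cover

variable {B : Type u} [Ring B]

/-- A finitely generated projective module together with a surjection onto `M`. -/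
structure ProjPresentation (M : FGModuleCat.{u} B) where
  P : FGModuleCat.{u} B
  projective : Module.Projective B P
  π : P →ₗ[B] M
  surjective : Function.Surjective π

/-- `π : P → M` is a projective cover: its kernel is superfluous. -/
def ProjPresentation.IsCover {M : FGModuleCat.{u} B} (c : ProjPresentation M) : Prop :=
  ∀ N : Submodule B c.P, N ⊔ LinearMap.ker c.π = ⊤ → N = ⊤

lemma exists_projPresentation (M : FGModuleCat.{u} B) :
    ∃ c : ProjPresentation M, (∃ c' : ProjPresentation M, c'.IsCover) → c.IsCover := by
  by_cases h : ∃ c' : ProjPresentation M, c'.IsCover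
  · exact ⟨h.choose, fun _ => h.choose_spec⟩
  · obtain ⟨n, f, hf⟩ := Module.Finite.exists_fin' B M
    exact ⟨⟨FGModuleCat.of B (Fin n → B), inferInstanceAs (Module.Projective B (Fin n → B)), f, hf⟩,
      fun h' => absurd h' h⟩

/-- A chosen projective cover of `M` (for a ring over which `M` has no projective cover, just a
surjection from a finitely generated projective module; this does not occur for module-finite
algebras over a complete noetherian local ring, which are semiperfect). -/
def cover (M : FGModuleCat.{u} B) : ProjPresentation M :=
  (exists_projPresentation M).choose

lemma cover_isCover {M : FGModuleCat.{u} B} (h : ∃ c : ProjPresentation M, c.IsCover) :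
    (cover M).IsCover :=
  (exists_projPresentation M).choose_spec h

end Cover

section Noetherian

lemma isNoetherianRing_of_finite (R : Type u) [CommRing R] [IsNoetherianRing R] (B : Type u) [Ring B] [Algebra R B] [Module.Finite R B] :
    IsNoetherianRing B :=
  isNoetherian_of_tower R (isNoetherian_of_isNoetherianRing_of_finite R B)

lemma finite_submodule (R : Type u) [CommRing R] [IsNoetherianRing R] {B : Type u} [Ring B] [Algebra R B] [Module.Finite R B]
    {M : Type u} [AddCommGroup M] [Module B M] [Module.Finite B M] (N : Submodule B M) :
    Module.Finite B N := by
  have := isNoetherianRing_of_finite R B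
  infer_instance

end Noetherian

section Syzygy

variable (R : Type u) [CommRing R] [IsNoetherianRing R]
  {B : Type u} [Ring B] [Algebra R B] [Module.Finite R B]

/-- The first syzygy `Ω M`: the kernel of the projective cover of `M`. -/
def syz (M : FGModuleCat.{u} B) : FGModuleCat.{u} B :=
  haveI := finite_submodule R (LinearMap.ker (cover M).π)
  FGModuleCat.of B (LinearMap.ker (cover M).π)

/-- The inclusion of `Ω M` in the projective cover of `M`. -/
def syzIncl (M : FGModuleCat.{u} B) : syz R M →ₗ[B] (cover M).P :=
  (LinearMap.ker (cover M).π).subtype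

/-- `Ω^n M`. -/
def syzPow (n : ℕ) (M : FGModuleCat.{u} B) : FGModuleCat.{u} B :=
  (syz R)^[n] M

end Syzygy

/-! ### The stable category, the functor `Ω` and periodicity -/

section Stable

variable (B : Type u) [Ring B]

/-- Two maps are identified if their difference factors through a projective. -/
def stableRel : HomRel (FGModuleCat.{u} B) :=
  fun _ _ f g => FactorsThroughProjective B (f.hom.hom - g.hom.hom)

instance : Congruence (stableRel B) where
  comp_left f g g' h := by
    have := FactorsThroughProjective.comp_right h f.hom.hom
    rwa [LinearMap.sub_comp] at this
  comp_right g h := by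
    have := FactorsThroughProjective.comp_left h g.hom.hom
    rwa [LinearMap.comp_sub] at this
  equivalence :=
    { refl := fun f => by
        change FactorsThroughProjective B _
        rw [sub_self]
        exact FactorsThroughProjective.zero
      symm := fun h => by
        have := FactorsThroughProjective.neg h
        rwa [neg_sub] at this
      trans := fun h h' => by
        have := FactorsThroughProjective.add h h'
        rwa [sub_add_sub_cancel] at this }

/-- The stable category of finitely generated `B`-modules. -/
abbrev StableCat : Type (u + 1) := CategoryTheory.Quotient (stableRel B)

end Stable

/-- A linear map as a morphism of the category of finitely generated modules. -/
def fgHom {B : Type u} [Ring B] {M N : FGModuleCat.{u} B} (f : M →ₗ[B] N) : M ⟶ N :=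
  ⟨ModuleCat.ofHom f⟩

section Functor

variable (R : Type u) [CommRing R] [IsNoetherianRing R]
  {B : Type u} [Ring B] [Algebra R B] [Module.Finite R B]

/-- `h : Ω M → Ω N` is induced by a lift of `f : M → N` to the projective covers. -/
def IsSyzMap {M N : FGModuleCat.{u} B} (f : M →ₗ[B] N) (h : syz R M →ₗ[B] syz R N) : Prop :=
  ∃ g : (cover M).P →ₗ[B] (cover N).P,
    (cover N).π ∘ₗ g = f ∘ₗ (cover M).π ∧ syzIncl R N ∘ₗ h = g ∘ₗ syzIncl R M

variable {R}

lemma cover_π_syzIncl {M : FGModuleCat.{u} B} (x : syz R M) : (cover M).π (syzIncl R M x) = 0 :=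
  x.2

lemma syzIncl_injective {M : FGModuleCat.{u} B} : Function.Injective (syzIncl R M) :=
  Subtype.val_injective

lemma exists_factor {N : FGModuleCat.{u} B} {L : Type u} [AddCommGroup L] [Module B L]
    (g : L →ₗ[B] (cover N).P) (hg : (cover N).π ∘ₗ g = 0) :
    ∃ h : L →ₗ[B] syz R N, syzIncl R N ∘ₗ h = g :=
  ⟨g.codRestrict (LinearMap.ker (cover N).π) fun x => LinearMap.congr_fun hg x, rfl⟩

lemma exists_isSyzMap {M N : FGModuleCat.{u} B} (f : M →ₗ[B] N) : ∃ h, IsSyzMap R f h := by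
  have := (cover M).projective
  obtain ⟨g, hg⟩ := Module.projective_lifting_property (cover N).π (f ∘ₗ (cover M).π)
    (cover N).surjective
  obtain ⟨h, hh⟩ := exists_factor (R := R) (g ∘ₗ syzIncl R M) (by
    ext x
    have := LinearMap.congr_fun hg (syzIncl R M x)
    simpa [cover_π_syzIncl] using this)
  exact ⟨h, g, hg, hh⟩

lemma IsSyzMap.sub {M N : FGModuleCat.{u} B} {f f' : M →ₗ[B] N} {h h' : syz R M →ₗ[B] syz R N}
    (H : IsSyzMap R f h) (H' : IsSyzMap R f' h') : IsSyzMap R (f - f') (h - h') := by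
  obtain ⟨g, hg, hh⟩ := H
  obtain ⟨g', hg', hh'⟩ := H'
  exact ⟨g - g', by rw [LinearMap.comp_sub, LinearMap.sub_comp, hg, hg'],
    by rw [LinearMap.comp_sub, LinearMap.sub_comp, hh, hh']⟩

lemma IsSyzMap.comp {M N K : FGModuleCat.{u} B} {f : M →ₗ[B] N} {f' : N →ₗ[B] K}
    {h : syz R M →ₗ[B] syz R N} {h' : syz R N →ₗ[B] syz R K}
    (H : IsSyzMap R f h) (H' : IsSyzMap R f' h') : IsSyzMap R (f' ∘ₗ f) (h' ∘ₗ h) := by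
  obtain ⟨g, hg, hh⟩ := H
  obtain ⟨g', hg', hh'⟩ := H'
  refine ⟨g' ∘ₗ g, ?_, ?_⟩
  · rw [← LinearMap.comp_assoc, hg', LinearMap.comp_assoc, hg, LinearMap.comp_assoc]
  · rw [← LinearMap.comp_assoc, hh', LinearMap.comp_assoc, hh, LinearMap.comp_assoc]

lemma IsSyzMap.id (M : FGModuleCat.{u} B) : IsSyzMap R (LinearMap.id : M →ₗ[B] M) LinearMap.id :=
  ⟨LinearMap.id, rfl, rfl⟩

lemma IsSyzMap.factors {M N : FGModuleCat.{u} B} {f : M →ₗ[B] N} {h : syz R M →ₗ[B] syz R N}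
    (H : IsSyzMap R f h) (hf : FactorsThroughProjective B f) : FactorsThroughProjective B h := by
  obtain ⟨g, hg, hh⟩ := H
  obtain ⟨Q, hQ, a, b, rfl⟩ := hf
  obtain ⟨b', hb'⟩ := Module.projective_lifting_property (cover N).π b (cover N).surjective
  obtain ⟨t, ht⟩ := exists_factor (R := R) (g - b' ∘ₗ a ∘ₗ (cover M).π) (by
    rw [LinearMap.comp_sub, ← LinearMap.comp_assoc, hb', hg, LinearMap.comp_assoc, sub_self])
  refine ⟨(cover M).P, (cover M).projective, syzIncl R M, t, ?_⟩
  ext x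
  apply syzIncl_injective
  have h1 := LinearMap.congr_fun hh x
  have h2 := LinearMap.congr_fun ht (syzIncl R M x)
  simp only [LinearMap.comp_apply, LinearMap.sub_apply, cover_π_syzIncl, map_zero, sub_zero]
    at h1 h2
  rw [h1, LinearMap.comp_apply, h2]

variable (R B)

/-- The syzygy functor `Ω` on the stable category of finitely generated `B`-modules: on objects it
is `Ω M`, on morphisms it is induced by lifting to projective covers. -/
def Omega : StableCat B ⥤ StableCat B :=
  CategoryTheory.Quotient.lift (stableRel B)
    { obj := fun M => (CategoryTheory.Quotient.functor (stableRel B)).obj (syz R M)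
      map := fun {M N} f => (CategoryTheory.Quotient.functor (stableRel B)).map
        (fgHom (exists_isSyzMap (R := R) (M := M) (N := N) f.hom.hom).choose)
      map_id := fun M => by
        rw [← CategoryTheory.Functor.map_id]
        apply CategoryTheory.Quotient.sound
        have H := (exists_isSyzMap (R := R) (M := M) (N := M) (𝟙 M : M ⟶ M).hom.hom).choose_spec
        refine IsSyzMap.factors (H.sub (IsSyzMap.id M)) ?_
        have : (𝟙 M : M ⟶ M).hom.hom - LinearMap.id = 0 := sub_self _
        rw [this]
        exact FactorsThroughProjective.zero
      map_comp := fun {M N K} f g => by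
        rw [← CategoryTheory.Functor.map_comp]
        apply CategoryTheory.Quotient.sound
        have H := (exists_isSyzMap (R := R) (M := M) (N := K) (f ≫ g).hom.hom).choose_spec
        have H1 := (exists_isSyzMap (R := R) (M := M) (N := N) f.hom.hom).choose_spec
        have H2 := (exists_isSyzMap (R := R) (M := N) (N := K) g.hom.hom).choose_spec
        refine IsSyzMap.factors (H.sub (H1.comp H2)) ?_
        have : (f ≫ g).hom.hom - g.hom.hom ∘ₗ f.hom.hom = 0 := sub_self _
        rw [this]
        exact FactorsThroughProjective.zero }
    (fun M N f g h => CategoryTheory.Quotient.sound _ (IsSyzMap.factors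
      ((exists_isSyzMap (R := R) (M := M) (N := N) f.hom.hom).choose_spec.sub
        (exists_isSyzMap (R := R) (M := M) (N := N) g.hom.hom).choose_spec) h))

/-- The functor `Ω^n` on the stable category. -/
def OmegaPow : ℕ → (StableCat B ⥤ StableCat B)
  | 0 => 𝟭 _
  | n + 1 => OmegaPow n ⋙ Omega R B

/-- The stable category of Cohen-Macaulay modules, as a full subcategory of the stable category of
finitely generated modules. -/
def stableCM [IsLocalRing R] : ObjectProperty (StableCat B) :=
  fun M => IsCMObj R M.as

/-- `A` is `l`-periodic: on the stable category of Cohen-Macaulay right `A`-modules, `Ω^l` is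
isomorphic to the identity functor.  (The identity and `Ω^l` are compared as functors into the
stable category of all finitely generated right modules, in which the stable category of
Cohen-Macaulay modules is a full subcategory.) -/
def IsPeriodic [IsLocalRing R] (A : Type u) [Ring A] [Algebra R A] [Module.Finite R A]
    (l : ℕ) : Prop :=
  Nonempty ((stableCM R Aᵐᵒᵖ).ι ⋙ OmegaPow R Aᵐᵒᵖ l ≅ (stableCM R Aᵐᵒᵖ).ι)

end Functor

/-! ### Duals, transpose, Auslander-Reiten translate, Nakayama functor -/

section Dual

variable (R : Type u) [CommRing R] [IsNoetherianRing R]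
  {A : Type u} [Ring A] [Algebra R A] [Module.Finite R A]

lemma finite_dual (R : Type u) [CommRing R] [IsNoetherianRing R]
    {A : Type u} [Ring A] [Algebra R A] [Module.Finite R A] (M : FGModuleCat.{u} Aᵐᵒᵖ) : Module.Finite A (M →ₗ[Aᵐᵒᵖ] A) := by
  have := isNoetherianRing_of_finite R A
  obtain ⟨n, f, hf⟩ := Module.Finite.exists_fin' Aᵐᵒᵖ M
  let e : (M →ₗ[Aᵐᵒᵖ] A) →ₗ[A] (Fin n → A) :=
    { toFun := fun φ i => φ (f (Pi.single i 1))
      map_add' := fun _ _ => rfl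
      map_smul' := fun _ _ => rfl }
  refine Module.Finite.of_injective e fun φ ψ h => ?_
  have : φ ∘ₗ f = ψ ∘ₗ f := by
    refine (Pi.basisFun Aᵐᵒᵖ (Fin n)).ext fun i => ?_
    have := congrFun h i
    simpa [e] using this
  ext x
  obtain ⟨y, rfl⟩ := hf x
  exact LinearMap.congr_fun this y

/-- For a right `A`-module `M`, the left `A`-module `M^* = Hom_A(M, A)`. -/
def dual (M : FGModuleCat.{u} Aᵐᵒᵖ) : FGModuleCat.{u} A :=
  haveI := finite_dual R M
  FGModuleCat.of A (M →ₗ[Aᵐᵒᵖ] A)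

/-- The differential `P₁ → P₀` of the minimal projective presentation `P₁ → P₀ → M → 0`. -/
def presMap (M : FGModuleCat.{u} Aᵐᵒᵖ) : (cover (syz R M)).P →ₗ[Aᵐᵒᵖ] (cover M).P :=
  syzIncl R M ∘ₗ (cover (syz R M)).π

/-- For a linear map `g` of right `A`-modules, the map `g^*` of left `A`-modules. -/
def dualMap {M N : FGModuleCat.{u} Aᵐᵒᵖ} (g : M →ₗ[Aᵐᵒᵖ] N) : dual R N →ₗ[A] dual R M :=
  ({ toFun := fun φ => φ ∘ₗ g
     map_add' := fun _ _ => rfl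
     map_smul' := fun _ _ => rfl } : (N →ₗ[Aᵐᵒᵖ] A) →ₗ[A] (M →ₗ[Aᵐᵒᵖ] A))

/-- The Auslander-Bridger transpose of a right `A`-module: the left `A`-module
`Tr M = coker (g^* : P₀^* → P₁^*)`, where `g : P₁ → P₀` is the minimal projective
presentation of `M`. -/
def transpose (M : FGModuleCat.{u} Aᵐᵒᵖ) : FGModuleCat.{u} A :=
  FGModuleCat.of A
    (dual R (cover (syz R M)).P ⧸ LinearMap.range (dualMap R (presMap R M)))

/-- `Tr_d M = Ω^d (Tr M)`. -/
def Trd (d : ℕ) (M : FGModuleCat.{u} Aᵐᵒᵖ) : FGModuleCat.{u} A :=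
  syzPow R d (transpose R M)

end Dual

/-- The evaluation map `Z → Z^**` of a left `A`-module; here `Z^* = Hom_A(Z, A)` is a right
`A`-module. -/
def evalMap (A : Type u) [Ring A] (Z : Type u) [AddCommGroup Z] [Module A Z] :
    Z →ₗ[A] ((Z →ₗ[A] A) →ₗ[Aᵐᵒᵖ] A) where
  toFun z :=
    { toFun := fun φ => φ z
      map_add' := fun _ _ => rfl
      map_smul' := fun _ _ => rfl }
  map_add' x y := by ext φ; exact map_add φ x y
  map_smul' a x := by ext φ; exact map_smul φ a x

/-- A left `A`-module is reflexive if the evaluation map to its bidual is an isomorphism. -/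
def IsReflexive (A : Type u) [Ring A] (Z : Type u) [AddCommGroup Z] [Module A Z] : Prop :=
  Function.Bijective (evalMap A Z)

section Matlis

variable (R : Type u) [CommRing R] {A : Type u} [Ring A] [Algebra R A]

/-- The underlying group of `Hom_R(Z, R)`, for a left `A`-module `Z`. -/
def BaseDual (Z : ModuleCat.{u} A) : Type u :=
  RestrictScalars R A Z →ₗ[R] R

instance (Z : ModuleCat.{u} A) : AddCommGroup (BaseDual R Z) :=
  inferInstanceAs (AddCommGroup (RestrictScalars R A Z →ₗ[R] R))

/-- `Hom_R(Z, R)` is a right `A`-module through `(f a)(z) = f (a z)`. -/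
instance (Z : ModuleCat.{u} A) : Module Aᵐᵒᵖ (BaseDual R Z) where
  smul a f := LinearMap.comp (M₂ := RestrictScalars R A Z) f (RestrictScalars.lsmul R A Z (unop a))
  one_smul f := by
    change LinearMap.comp (M₂ := RestrictScalars R A Z) f (RestrictScalars.lsmul R A Z 1) = f
    rw [map_one]; rfl
  mul_smul a b f := by
    change LinearMap.comp (M₂ := RestrictScalars R A Z) f
      (RestrictScalars.lsmul R A Z (unop b * unop a)) = _
    rw [map_mul]; rfl
  smul_zero a := rfl
  smul_add a f g := rfl
  add_smul a b f := by
    change LinearMap.comp (M₂ := RestrictScalars R A Z) f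
      (RestrictScalars.lsmul R A Z (unop a + unop b)) = _
    rw [map_add]
    exact LinearMap.comp_add _ _ _
  zero_smul f := by
    change LinearMap.comp (M₂ := RestrictScalars R A Z) f (RestrictScalars.lsmul R A Z 0) = _
    rw [map_zero]
    exact LinearMap.comp_zero _

lemma BaseDual.smul_apply (Z : ModuleCat.{u} A) (a : A) (f : BaseDual R Z) (z : Z) :
    (show RestrictScalars R A Z →ₗ[R] R from op a • f) z =
      (show RestrictScalars R A Z →ₗ[R] R from f) (a • z : Z) :=
  rfl

/-- The duality `D_d = Hom_R(-, R)`, from left to right `A`-modules. -/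
def Dd (Z : FGModuleCat.{u} A) : ModuleCat.{u} Aᵐᵒᵖ :=
  ModuleCat.of Aᵐᵒᵖ (BaseDual R Z.obj)

end Matlis

section AR

variable (R : Type u) [CommRing R] [IsNoetherianRing R]
  {A : Type u} [Ring A] [Algebra R A] [Module.Finite R A]

/-- The Auslander-Reiten translate `τ = D_d Tr_d`. -/
def tau (d : ℕ) (M : FGModuleCat.{u} Aᵐᵒᵖ) : ModuleCat.{u} Aᵐᵒᵖ :=
  Dd R (Trd R d M)

/-- The Nakayama functor `ν = D_d (-)^*`. -/
def nakayama (M : FGModuleCat.{u} Aᵐᵒᵖ) : ModuleCat.{u} Aᵐᵒᵖ :=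
  Dd R (dual R M)

end AR

end CMOrder

end

/-!
The key point is that periodicity of positive period is very restrictive.  As `Ω^{2d}` is naturally
isomorphic to the identity of the stable category of Cohen-Macaulay modules, a map `f` of
Cohen-Macaulay modules such that `Ω f` is a stable isomorphism is a stable isomorphism itself if
`d > 0` (`isIso_of_isIso_omega`).  The projection `E → M` of an extension of a Cohen-Macaulay
module `M` by `A` is such a map: both modules have the same syzygy up to projectives.  A surjective
stable isomorphism splits, hence `Ext^1(M, A) = 0` for all Cohen-Macaulay `M`
(`syzygyMapsExtend_of_periodic`), and by dimension shifting all `Ext^i(X, A)` with `i > 0` vanish.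

Now let `d > 0`.  Restricting functionals on `P₁` to the second syzygy `Ω² X ⊆ P₁` gives a map
`Tr X → (Ω² X)^*`, which is injective if and only if `Ext^1(X, A) = 0` and surjective if and only if
`Ext^2(X, A) = 0` (`transposeToDual_injective_iff`, `transposeToDual_surjective_iff`).  Since
`(-)^*` now takes the sequences `0 → Ω M → P → M → 0` to exact sequences, the syzygies
of `(Ω^{2d+2} X)^*`, stably `(Ω² X)^* ≅ Tr X`, are the duals of lower syzygies of `X`; in particular
`Tr_d X` is stably isomorphic to `(Ω^{d+2} X)^*`.  Neither of the two has projective summands, so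
they are isomorphic by a Fitting argument over the complete ring `R` (`nonempty_Trd_equiv`).  As
`Ω^{d+2} X` is reflexive, so is its dual `Tr_d X`, and applying `D_d` gives `τ X ≅ ν Ω^{d+2} X`.
Thus all three conditions hold.

For `d = 0` periodicity carries no information.  Here `Ω² X` is always the dual of `Tr X`, and
the map `Tr X → (Ω² X)^*` becomes the evaluation map of `Tr X`; so the first two conditions both
say that this map is bijective (`isReflexive_transpose_iff`).  The third follows by applying `D_0`.
Conversely, the Gorenstein ring `R` is self-injective in dimension zero
(`injective_of_isGorensteinLocal`), so `D_0` is a duality and the third condition yields some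
isomorphism `Tr X ≅ (Ω² X)^*`; that any such isomorphism forces the natural map to be bijective is
`bijective_transposeToDual_of_equiv`.
-/

noncomputable section

namespace CMOrder

/-! ### Fitting decompositions over a complete local ring -/

section Fitting

/-- A finitely generated module over a complete noetherian ring is precomplete. -/
lemma isPrecomplete_of_finite {R M : Type*} [CommRing R] [AddCommGroup M] [Module R M]
    [Module.Finite R M] (I : Ideal R) [IsPrecomplete I R] : IsPrecomplete I M := by
  rw [← AdicCompletion.of_surjective_iff]
  intro y
  obtain ⟨t, rfl⟩ := AdicCompletion.ofTensorProduct_surjective_of_finite I M y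
  induction t with
  | zero => exact ⟨0, by simp⟩
  | tmul r x =>
    obtain ⟨r, rfl⟩ := AdicCompletion.of_surjective I R r
    refine ⟨r • x, ?_⟩
    rw [AdicCompletion.ofTensorProduct_tmul, map_smul]
    ext n
    rfl
  | add x y hx hy =>
    obtain ⟨a, ha⟩ := hx
    obtain ⟨b, hb⟩ := hy
    exact ⟨a + b, by rw [map_add, map_add, ha, hb]⟩

/-- Idempotents lift along the quotient by an ideal for which the ring is complete: this is
Hensel's lemma for the polynomial `X ^ 2 - X`. -/
lemma exists_idempotent_sub_mem {S : Type*} [CommRing S] (J : Ideal S) [IsAdicComplete J S] (a : S)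
    (ha : a * a - a ∈ J) : ∃ e, e * e = e ∧ e - a ∈ J := by
  have hd : (Polynomial.X ^ 2 - Polynomial.X : Polynomial S).derivative.eval a = 2 * a - 1 := by
    simp
    ring
  have hm : (Polynomial.X ^ 2 - Polynomial.X : Polynomial S).Monic := by
    nontriviality S
    exact Polynomial.monic_X_pow_sub (by rw [Polynomial.degree_X]; norm_num)
  obtain ⟨e, he, hea⟩ := HenselianRing.is_henselian (I := J)
    _ hm a (by simpa [sq] using ha) (by
      rw [hd]
      refine IsUnit.of_mul_eq_one (Ideal.Quotient.mk J (2 * a - 1)) ?_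
      rw [← map_mul, ← map_one (Ideal.Quotient.mk J), Ideal.Quotient.eq]
      have : (2 * a - 1) * (2 * a - 1) - 1 = 4 * (a * a - a) := by ring
      rw [this]
      exact J.mul_mem_left _ ha)
  refine ⟨e, ?_, hea⟩
  simp only [Polynomial.IsRoot.def, Polynomial.eval_sub, Polynomial.eval_pow,
    Polynomial.eval_X] at he
  linear_combination he

/-- Modulo an ideal with artinian quotient, some power of `h` is divisible by its square. -/
lemma exists_pow_sub_mul_mem {S : Type*} [CommRing S] (J : Ideal S) [IsArtinianRing (S ⧸ J)]
    (h : S) : ∃ n, ∃ c : S, h ^ (n + 1) - h ^ (n + 1) * h ^ (n + 1) * c ∈ J := by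
  obtain ⟨n, y, hy⟩ := IsArtinian.exists_pow_succ_smul_dvd (Ideal.Quotient.mk J h) (1 : S ⧸ J)
  obtain ⟨y, rfl⟩ := Ideal.Quotient.mk_surjective y
  have hy' : h ^ n - h ^ (n + 1) * y ∈ J := by
    rw [← Ideal.Quotient.eq]
    simpa using hy.symm
  have key : ∀ k, ∃ z : S, h ^ n - h ^ n * h ^ k * z ∈ J := by
    intro k
    induction k with
    | zero => exact ⟨1, by simp⟩
    | succ k ih =>
      obtain ⟨z, hz⟩ := ih
      refine ⟨y * z, ?_⟩
      have e1 : h ^ n - h ^ n * h ^ (k + 1) * (y * z)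
          = (h ^ n - h ^ n * h ^ k * z) + (h ^ k * z) * (h ^ n - h ^ (n + 1) * y) := by ring
      rw [e1]
      exact J.add_mem hz (J.mul_mem_left _ hy')
  obtain ⟨z, hz⟩ := key (n + 2)
  refine ⟨n, h * z, ?_⟩
  have e1 : h ^ (n + 1) - h ^ (n + 1) * h ^ (n + 1) * (h * z)
      = h * (h ^ n - h ^ n * h ^ (n + 2) * z) := by ring
  rw [e1]
  exact J.mul_mem_left _ hz

variable {R : Type*} [CommRing R] [IsLocalRing R] [IsNoetherianRing R]
  [IsAdicComplete (IsLocalRing.maximalIdeal R) R]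

open IsLocalRing in
/-- Fitting decomposition of an element `h` of a commutative finite algebra `S` over a complete
local ring: an idempotent `e` such that `h` is invertible on `e S` and topologically nilpotent
on `(1 - e) S`.  It is lifted from the artinian ring `S / 𝔪 S`. -/
lemma exists_idempotent_fitting_of_comm {S : Type*} [CommRing S] [Algebra R S] [Module.Finite R S]
    (h : S) : ∃ e g : S, e * e = e ∧ g * h * e = e ∧
      ∃ N, h ^ N * (1 - e) ∈ (maximalIdeal R).map (algebraMap R S) := by
  set J := (maximalIdeal R).map (algebraMap R S) with hJ
  have hc : IsAdicComplete J S := by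
    have h1 : IsPrecomplete (maximalIdeal R) S := isPrecomplete_of_finite _
    have h2 : IsHausdorff (maximalIdeal R) S := inferInstance
    exact { toIsHausdorff := IsHausdorff.map_algebraMap_iff.2 h2
            toIsPrecomplete := IsPrecomplete.map_algebraMap_iff.2 h1 }
  have hart : IsArtinianRing (S ⧸ J) := by
    let : Algebra (R ⧸ maximalIdeal R) (S ⧸ J) :=
      (Ideal.quotientMap J (algebraMap R S) Ideal.le_comap_map).toAlgebra
    have : IsScalarTower R (R ⧸ maximalIdeal R) (S ⧸ J) := .of_algebraMap_eq fun x => rfl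
    have : Module.Finite (R ⧸ maximalIdeal R) (S ⧸ J) :=
      Module.Finite.of_restrictScalars_finite R _ _
    let := Ideal.Quotient.field (maximalIdeal R)
    exact IsArtinianRing.of_finite (R ⧸ maximalIdeal R) (S ⧸ J)
  obtain ⟨n, c, hac⟩ := exists_pow_sub_mul_mem J h
  obtain ⟨a, ha⟩ : ∃ a, a = h ^ (n + 1) := ⟨_, rfl⟩
  rw [← ha] at hac
  obtain ⟨e, hee, hea⟩ := exists_idempotent_sub_mem J (a * c) (by
    have : (a * c) * (a * c) - a * c = -c * (a - a * a * c) := by ring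
    rw [this]
    exact J.mul_mem_left _ hac)
  -- `h ^ n * c` inverts `h` on `e S` up to the unit `u`
  obtain ⟨u, hu⟩ : ∃ u, u * (a * c - e + 1) = 1 := by
    have h1 : a * c - e ∈ J := by
      have := J.neg_mem hea
      rwa [neg_sub] at this
    have := Ideal.mem_jacobson_bot.1 (IsAdicComplete.le_jacobson_bot J h1) 1
    rw [mul_one] at this
    exact this.exists_left_inv
  refine ⟨e, u * (h ^ n * c), hee, ?_, n + 1, ?_⟩
  · have h2 : u * (h ^ n * c) * h * e = u * (a * c * e) := by rw [ha]; ring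
    rw [h2]
    linear_combination e * hu + u * hee
  · have : a * (1 - e) = (a - a * a * c) - a * (e - a * c) := by ring
    rw [← ha, this]
    exact J.sub_mem hac (J.mul_mem_left _ hea)

variable {B : Type*} [Ring B] [Algebra R B] {M : Type*} [AddCommGroup M] [Module R M] [Module B M]
  [IsScalarTower R B M] [Module.Finite R M]

open IsLocalRing in
/-- Fitting decomposition of an endomorphism `h` of a finitely generated module: an idempotent `e`
commuting with `h` such that `h` is bijective on the range of `e` and topologically nilpotent
on its kernel. -/
lemma exists_idempotent_fitting (h : M →ₗ[B] M) :
    ∃ e g : M →ₗ[B] M, e ∘ₗ e = e ∧ e ∘ₗ h = h ∘ₗ e ∧ g ∘ₗ h = h ∘ₗ g ∧ g ∘ₗ h ∘ₗ e = e ∧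
      ∃ N, ∀ x, ((h : Module.End B M) ^ N) (x - e x) ∈ maximalIdeal R • (⊤ : Submodule R M) := by
  have : SMulCommClass B R M := IsScalarTower.to_smulCommClass'
  let F : Polynomial R →ₐ[R] Module.End B M := Polynomial.aeval h
  let S := Polynomial R ⧸ RingHom.ker F
  obtain ⟨p, hp, hpR⟩ := LinearMap.exists_monic_and_aeval_eq_zero R (h.restrictScalars R)
  have hpF : p ∈ RingHom.ker F := by
    rw [RingHom.mem_ker]
    ext y
    have h1 := LinearMap.congr_fun hpR y
    rw [Polynomial.aeval_eq_sum_range, LinearMap.sum_apply] at h1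
    change Polynomial.aeval h p y = _
    rw [Polynomial.aeval_eq_sum_range, LinearMap.sum_apply]
    simpa [Module.End.pow_apply] using h1
  have : Module.Finite R S := by
    have h1 : Module.Finite R (AdjoinRoot p) := hp.finite_adjoinRoot
    have : Module.Finite R (Polynomial R ⧸ Ideal.span {p}) := h1
    have hle := (Ideal.span_singleton_le_iff_mem _).2 hpF
    exact Module.Finite.of_surjective (Ideal.Quotient.factorₐ R hle).toLinearMap
      (Ideal.Quotient.factor_surjective hle)
  let G : S →ₐ[R] Module.End B M := Ideal.Quotient.liftₐ _ F fun a ha => ha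
  let x : S := Ideal.Quotient.mk _ Polynomial.X
  have hx : G x = h := Polynomial.aeval_X h
  obtain ⟨e, g, he, hg, N, hN⟩ := exists_idempotent_fitting_of_comm (R := R) x
  have hJ : ∀ s ∈ (maximalIdeal R).map (algebraMap R S), ∀ y : M,
      G s y ∈ maximalIdeal R • (⊤ : Submodule R M) := by
    intro s hs
    induction hs using Submodule.span_induction with
    | mem s hs =>
      obtain ⟨r, hr, rfl⟩ := hs
      intro y
      rw [AlgHom.commutes]
      exact Submodule.smul_mem_smul hr trivial
    | zero => simp
    | add a b _ _ ha hb => intro y; rw [map_add]; exact Submodule.add_mem _ (ha y) (hb y)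
    | smul a b _ hb =>
      intro y
      rw [smul_eq_mul, mul_comm, map_mul]
      exact hb _
  refine ⟨G e, G g, ?_, ?_, ?_, ?_, N, fun y => ?_⟩
  · change G e * G e = G e
    rw [← map_mul, he]
  · change G e * h = h * G e
    rw [← hx, ← map_mul, ← map_mul, mul_comm]
  · change G g * h = h * G g
    rw [← hx, ← map_mul, ← map_mul, mul_comm]
  · change G g * (h * G e) = G e
    rw [← hx, ← map_mul, ← map_mul, ← mul_assoc, hg]
  · have h1 := hJ _ hN y
    rwa [map_mul, map_pow, hx, map_sub, map_one] at h1

end Fitting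

section FittingModule

variable (R : Type u) [CommRing R] [IsLocalRing R] [IsNoetherianRing R]
  [IsAdicComplete (IsLocalRing.maximalIdeal R) R]
  {B : Type u} [Ring B] [Algebra R B] [Module.Finite R B]

include R in
open IsLocalRing in
/-- Fitting decomposition in terms of `B` alone: `h` is surjective on the range of the
idempotent `e`, and `1 - h` is surjective on its kernel. -/
lemma exists_idempotent_surjective {M : Type u} [AddCommGroup M] [Module B M] [Module.Finite B M]
    (h : M →ₗ[B] M) :
    ∃ e g : M →ₗ[B] M, e ∘ₗ e = e ∧ h ∘ₗ g ∘ₗ e = e ∧ ∀ x, ∃ y, y - h y = x - e x := by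
  let : Module R M := Module.restrictScalars R B M
  have : IsScalarTower R B M := IsScalarTower.of_algebraMap_smul fun _ _ => rfl
  have : Module.Finite R M := Module.Finite.trans B M
  obtain ⟨e, g, he, hcomm, hgh, hge, N, hN⟩ := exists_idempotent_fitting (R := R) h
  refine ⟨e, g, he, ?_, ?_⟩
  · rw [← LinearMap.comp_assoc, ← hgh, LinearMap.comp_assoc, hge]
  let T := LinearMap.range ((LinearMap.id - h).restrictScalars R)
  let L := LinearMap.range ((LinearMap.id - e).restrictScalars R)
  have hpow : ∀ n x, x - ((h : Module.End B M) ^ n) x ∈ T := by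
    intro n x
    induction n with
    | zero => simp
    | succ n ih =>
      have : x - ((h : Module.End B M) ^ (n + 1)) x = (x - ((h : Module.End B M) ^ n) x)
          + (((h : Module.End B M) ^ n) x - h (((h : Module.End B M) ^ n) x)) := by
        rw [pow_succ', Module.End.mul_apply]
        abel
      rw [this]
      exact T.add_mem ih ⟨_, rfl⟩
  have hee : ∀ x, e (e x) = e x := fun x => LinearMap.congr_fun he x
  have hcommN : ∀ x, e (((h : Module.End B M) ^ N) x) = ((h : Module.End B M) ^ N) (e x) := by
    intro x
    have : Commute (e : Module.End B M) h := hcomm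
    exact LinearMap.congr_fun (this.pow_right N) x
  have hLT : L ≤ T ⊔ maximalIdeal R • L := by
    rintro _ ⟨x, rfl⟩
    have h2 : ((h : Module.End B M) ^ N) (x - e x) ∈ maximalIdeal R • L := by
      have h3 : ((h : Module.End B M) ^ N) (x - e x)
          = (LinearMap.id - e).restrictScalars R (((h : Module.End B M) ^ N) (x - e x)) := by
        simp [hcommN, hee]
      rw [h3]
      have := Submodule.mem_map_of_mem (f := (LinearMap.id - e).restrictScalars R) (hN x)
      rwa [Submodule.map_smul'', Submodule.map_top] at this
    have h1 := hpow N (x - e x)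
    have := Submodule.add_mem_sup h1 h2
    simpa using this
  have : L ≤ T := Submodule.le_of_le_smul_of_le_jacobson_bot
    (IsNoetherian.noetherian L) (maximalIdeal_le_jacobson _) hLT
  exact fun x => this ⟨x, rfl⟩

include R in
/-- Every finitely generated module over a finite algebra over a complete local ring has a
projective cover.  Split off from a finitely generated free module the largest possible summand
lying in the kernel; what remains covers `M`, since by Fitting every lift of the identity
of `M` is surjective. -/
lemma cover_isCover_of_complete (M : FGModuleCat.{u} B) : (cover M).IsCover := by
  have := isNoetherianRing_of_finite R B
  refine cover_isCover ?_
  obtain ⟨n, f, hf⟩ := Module.Finite.exists_fin' B M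
  obtain ⟨_, ⟨e₀, he₀, hfe₀, rfl⟩, hmax⟩ := set_has_maximal_iff_noetherian.2
    (inferInstanceAs (IsNoetherian B (Fin n → B)))
    {K | ∃ e : (Fin n → B) →ₗ[B] (Fin n → B), e ∘ₗ e = e ∧ f ∘ₗ e = f ∧ K = LinearMap.ker e}
    ⟨_, LinearMap.id, rfl, rfl, rfl⟩
  let P := LinearMap.range e₀
  let r : (Fin n → B) →ₗ[B] P := e₀.rangeRestrict
  have hr : r ∘ₗ P.subtype = LinearMap.id := by
    refine LinearMap.ext ?_
    rintro ⟨_, y, rfl⟩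
    exact Subtype.ext (show e₀ (e₀ y) = e₀ y from LinearMap.congr_fun he₀ y)
  have hP : Module.Projective B P := Module.Projective.of_split P.subtype r hr
  let π : P →ₗ[B] M := f ∘ₗ P.subtype
  have hπr : π ∘ₗ r = f := hfe₀
  have hπ : Function.Surjective π := fun m => by
    obtain ⟨x, rfl⟩ := hf m
    exact ⟨r x, LinearMap.congr_fun hπr x⟩
  refine ⟨⟨FGModuleCat.of B P, hP, π, hπ⟩, fun (N : Submodule B P) hN => ?_⟩
  change N ⊔ LinearMap.ker π = ⊤ at hN
  have hπN : Function.Surjective (π ∘ₗ N.subtype) := fun m => by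
    obtain ⟨x, rfl⟩ := hπ m
    obtain ⟨y, hy, z, hz, rfl⟩ := Submodule.mem_sup.1 (hN ▸ Submodule.mem_top : x ∈ N ⊔ _)
    exact ⟨⟨y, hy⟩, by simp [LinearMap.mem_ker.1 hz]⟩
  -- a lift of `π` to an endomorphism of `P` with values in `N`
  obtain ⟨q, hq⟩ := Module.projective_lifting_property _ π hπN
  have hπh : ∀ x, π (q x : P) = π x := fun x => LinearMap.congr_fun hq x
  obtain ⟨e, g, he, hge, hsurj⟩ := exists_idempotent_surjective R (N.subtype ∘ₗ q)
  have hπe : π ∘ₗ e = π := by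
    ext x
    obtain ⟨y, hy⟩ := hsurj x
    have := congrArg π hy
    simp only [LinearMap.comp_apply, Submodule.subtype_apply, map_sub, hπh, sub_self] at this
    exact (sub_eq_zero.1 this.symm).symm
  have hrs : ∀ x : P, r x = x := fun x => LinearMap.congr_fun hr x
  have hle : LinearMap.ker e₀ ≤ LinearMap.ker (P.subtype ∘ₗ e ∘ₗ r) := by
    intro x hx
    have : r x = 0 := Subtype.ext hx
    simp [this]
  -- by maximality of the kernel, the Fitting idempotent `e` of this endomorphism is the identity
  have hker := eq_of_le_of_not_lt hle (hmax _ ⟨P.subtype ∘ₗ e ∘ₗ r, by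
    refine LinearMap.ext fun x => ?_
    have := LinearMap.congr_fun he (r x)
    simpa [hrs] using this, by
    rw [← LinearMap.comp_assoc]
    change π ∘ₗ e ∘ₗ r = f
    rw [← LinearMap.comp_assoc, hπe, hπr], rfl⟩)
  have he1 : ∀ x, e x = x := by
    intro x
    have h1 : ((x - e x : P) : Fin n → B) ∈ LinearMap.ker e₀ := by
      have := LinearMap.congr_fun he x
      rw [hker, LinearMap.mem_ker]
      rw [LinearMap.comp_apply] at this
      simp [hrs, this]
    have h2 : r (x - e x : P) = 0 := Subtype.ext h1
    rw [hrs, sub_eq_zero] at h2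
    exact h2.symm
  rw [eq_top_iff]
  intro x _
  have := LinearMap.congr_fun hge x
  rw [LinearMap.comp_apply, LinearMap.comp_apply, he1] at this
  rw [← this]
  exact (q _).2

end FittingModule

/-! ### Stable isomorphisms -/

section StablyIso

variable {B : Type u} [Ring B]

/-- The modules `M` and `N` are isomorphic in the stable category. -/
def StablyIso (M N : FGModuleCat.{u} B) : Prop :=
  ∃ (f : M →ₗ[B] N) (g : N →ₗ[B] M), FactorsThroughProjective B (g ∘ₗ f - LinearMap.id) ∧
    FactorsThroughProjective B (f ∘ₗ g - LinearMap.id)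

lemma StablyIso.refl (M : FGModuleCat.{u} B) : StablyIso M M :=
  ⟨LinearMap.id, LinearMap.id, by simpa using FactorsThroughProjective.zero,
    by simpa using FactorsThroughProjective.zero⟩

lemma StablyIso.symm {M N : FGModuleCat.{u} B} (h : StablyIso M N) : StablyIso N M := by
  obtain ⟨f, g, h1, h2⟩ := h
  exact ⟨g, f, h2, h1⟩

lemma StablyIso.trans {M N L : FGModuleCat.{u} B} (h : StablyIso M N) (h' : StablyIso N L) :
    StablyIso M L := by
  obtain ⟨f, g, h1, h2⟩ := h
  obtain ⟨f', g', h1', h2'⟩ := h'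
  refine ⟨f' ∘ₗ f, g ∘ₗ g', ?_, ?_⟩
  · convert ((h1'.comp_left g).comp_right f).add h1 using 1
    ext x
    simp
  · convert ((h2.comp_left f').comp_right g').add h2' using 1
    ext x
    simp

lemma StablyIso.of_equiv {M N : FGModuleCat.{u} B} (e : M ≃ₗ[B] N) : StablyIso M N :=
  ⟨e.toLinearMap, e.symm.toLinearMap, by simpa using FactorsThroughProjective.zero,
    by simpa using FactorsThroughProjective.zero⟩

lemma StablyIso.syz {R : Type u} [CommRing R] [IsNoetherianRing R] [Algebra R B] [Module.Finite R B]
    {M N : FGModuleCat.{u} B} (h : StablyIso M N) : StablyIso (syz R M) (syz R N) := by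
  obtain ⟨f, g, h1, h2⟩ := h
  obtain ⟨f', hf'⟩ := exists_isSyzMap (R := R) f
  obtain ⟨g', hg'⟩ := exists_isSyzMap (R := R) g
  exact ⟨f', g', ((hf'.comp hg').sub (IsSyzMap.id M)).factors h1,
    ((hg'.comp hf').sub (IsSyzMap.id N)).factors h2⟩

lemma syzPow_succ' {R : Type u} [CommRing R] [IsNoetherianRing R] [Algebra R B] [Module.Finite R B]
    (n : ℕ) (M : FGModuleCat.{u} B) : syzPow R (n + 1) M = syz R (syzPow R n M) :=
  Function.iterate_succ_apply' _ _ _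

lemma StablyIso.syzPow {R : Type u} [CommRing R] [IsNoetherianRing R] [Algebra R B]
    [Module.Finite R B] {M N : FGModuleCat.{u} B} (h : StablyIso M N) (n : ℕ) :
    StablyIso (syzPow R n M) (syzPow R n N) := by
  induction n with
  | zero => exact h
  | succ n ih =>
    rw [syzPow_succ', syzPow_succ']
    exact ih.syz

/-- A map killed by `π` factors through any kernel of `π`. -/
lemma exists_lift_of_exact {K P M L : Type*} [AddCommGroup K] [Module B K] [AddCommGroup P]
    [Module B P] [AddCommGroup M] [Module B M] [AddCommGroup L] [Module B L]
    {ι : K →ₗ[B] P} {π : P →ₗ[B] M} (hι : Function.Injective ι) (hex : Function.Exact ι π)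
    (g : L →ₗ[B] P) (hg : π ∘ₗ g = 0) : ∃ t : L →ₗ[B] K, ι ∘ₗ t = g := by
  refine ⟨(LinearEquiv.ofInjective ι hι).symm.toLinearMap ∘ₗ
    g.codRestrict (LinearMap.range ι) fun x => (hex _).1 (LinearMap.congr_fun hg x), ?_⟩
  ext x
  exact LinearEquiv.ofInjective_symm_apply (f := ι) (h := hι)
    (g.codRestrict (LinearMap.range ι) (fun x => (hex _).1 (LinearMap.congr_fun hg x)) x)

/-- Schanuel's lemma in the stable category: kernels of projective presentations are determined
up to stable isomorphism.  The isomorphism is compatible with lifts of the identity of `M`. -/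
lemma exists_stable_inverse {K P M K' P' : Type u} [AddCommGroup K] [Module B K] [AddCommGroup P]
    [Module B P] [AddCommGroup M] [Module B M] [AddCommGroup K'] [Module B K'] [AddCommGroup P']
    [Module B P'] [Module.Finite B P] [Module.Projective B P] [Module.Finite B P']
    [Module.Projective B P']
    {ι : K →ₗ[B] P} {π : P →ₗ[B] M} (hι : Function.Injective ι) (hex : Function.Exact ι π)
    (hπ : Function.Surjective π) {ι' : K' →ₗ[B] P'} {π' : P' →ₗ[B] M} (hι' : Function.Injective ι')
    (hex' : Function.Exact ι' π') (hπ' : Function.Surjective π') :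
    ∃ (u : K →ₗ[B] K') (v : K' →ₗ[B] K),
      FactorsThroughProjective B (v ∘ₗ u - LinearMap.id) ∧
      FactorsThroughProjective B (u ∘ₗ v - LinearMap.id) ∧
      ∃ α : P →ₗ[B] P', π' ∘ₗ α = π ∧ ι' ∘ₗ u = α ∘ₗ ι := by
  obtain ⟨α, hα⟩ := Module.projective_lifting_property π' π hπ'
  obtain ⟨β, hβ⟩ := Module.projective_lifting_property π π' hπ
  obtain ⟨u, hu⟩ := exists_lift_of_exact hι' hex' (α ∘ₗ ι) (by
    rw [← LinearMap.comp_assoc, hα, hex.linearMap_comp_eq_zero])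
  obtain ⟨v, hv⟩ := exists_lift_of_exact hι hex (β ∘ₗ ι') (by
    rw [← LinearMap.comp_assoc, hβ, hex'.linearMap_comp_eq_zero])
  obtain ⟨s, hs⟩ := exists_lift_of_exact hι hex (β ∘ₗ α - LinearMap.id) (by
    rw [LinearMap.comp_sub, ← LinearMap.comp_assoc, hβ, hα, LinearMap.comp_id, sub_self])
  obtain ⟨t, ht⟩ := exists_lift_of_exact hι' hex' (α ∘ₗ β - LinearMap.id) (by
    rw [LinearMap.comp_sub, ← LinearMap.comp_assoc, hα, hβ, LinearMap.comp_id, sub_self])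
  refine ⟨u, v, ⟨FGModuleCat.of B P, ‹_›, ι, s, ?_⟩, ⟨FGModuleCat.of B P', ‹_›, ι', t, ?_⟩,
    α, hα, hu⟩
  · ext x
    apply hι
    have h1 := LinearMap.congr_fun hs (ι x)
    have h2 := LinearMap.congr_fun hu x
    have h3 := LinearMap.congr_fun hv (u x)
    simp only [LinearMap.comp_apply, LinearMap.sub_apply, LinearMap.id_apply, map_sub]
      at h1 h2 h3 ⊢
    rw [h1, h3, h2]
  · ext x
    apply hι'
    have h1 := LinearMap.congr_fun ht (ι' x)
    have h2 := LinearMap.congr_fun hv x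
    have h3 := LinearMap.congr_fun hu (v x)
    simp only [LinearMap.comp_apply, LinearMap.sub_apply, LinearMap.id_apply, map_sub]
      at h1 h2 h3 ⊢
    rw [h1, h3, h2]

lemma syz_exact (R : Type u) [CommRing R] [IsNoetherianRing R] [Algebra R B] [Module.Finite R B]
    (M : FGModuleCat.{u} B) : Function.Exact (syzIncl R M) (cover M).π :=
  LinearMap.exact_subtype_ker_map _

/-- A finitely generated module without nonzero projective direct summands: no nonzero idempotent
endomorphism factors through a projective. -/
def HasNoProjectiveSummand (M : FGModuleCat.{u} B) : Prop :=
  ∀ e : M →ₗ[B] M, e ∘ₗ e = e → FactorsThroughProjective B e → e = 0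

/-- An endomorphism that is stably the identity is surjective on a module without projective
summands: by Fitting, an idempotent factoring through a projective measures its failure. -/
lemma HasNoProjectiveSummand.surjective (R : Type u) [CommRing R] [IsLocalRing R]
    [IsNoetherianRing R] [IsAdicComplete (IsLocalRing.maximalIdeal R) R] [Algebra R B]
    [Module.Finite R B] {M : FGModuleCat.{u} B} (hM : HasNoProjectiveSummand M) {f : M →ₗ[B] M}
    (hf : FactorsThroughProjective B (f - LinearMap.id)) : Function.Surjective f := by
  obtain ⟨e, g, he, hge, hsurj⟩ := exists_idempotent_surjective R (LinearMap.id - f)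
  have h1 : FactorsThroughProjective B e := by
    have := hf.neg.comp_right (g ∘ₗ e)
    rwa [neg_sub, hge] at this
  intro x
  obtain ⟨y, hy⟩ := hsurj x
  exact ⟨y, by simpa [hM e he h1] using hy⟩

/-- Stably isomorphic modules without projective summands are isomorphic. -/
lemma StablyIso.nonempty_equiv (R : Type u) [CommRing R] [IsLocalRing R]
    [IsNoetherianRing R] [IsAdicComplete (IsLocalRing.maximalIdeal R) R] [Algebra R B]
    [Module.Finite R B] {M N : FGModuleCat.{u} B} (h : StablyIso M N)
    (hM : HasNoProjectiveSummand M) (hN : HasNoProjectiveSummand N) : Nonempty (M ≃ₗ[B] N) := by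
  obtain ⟨f, g, h1, h2⟩ := h
  have := isNoetherianRing_of_finite R B
  have hgf := hM.surjective R h1
  have hfg := hN.surjective R h2
  have hinj := IsNoetherian.injective_of_surjective_endomorphism _ hgf
  exact ⟨LinearEquiv.ofBijective f ⟨Function.Injective.of_comp (f := g) hinj,
    Function.Surjective.of_comp (g := g) hfg⟩⟩

end StablyIso

/-! ### Cohen-Macaulay modules through Ext -/

section CM

open IsLocalRing

variable {R : Type u} [CommRing R] [IsLocalRing R] [IsNoetherianRing R] {d : ℕ}

/-- Regular sequences have length at most `dim R`, and on a module with a regular sequence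
of length `dim R` the support has dimension `dim R`. -/
lemma length_le_of_isRegular (hd : ringKrullDim R = d) {M : Type u} [AddCommGroup M] [Module R M]
    [Module.Finite R M] {rs : List R} (hrs : RingTheory.Sequence.IsRegular M rs) :
    rs.length ≤ d ∧ (d ≤ rs.length → Module.supportDim R M = d) := by
  have h1 := Module.supportDim_add_length_eq_supportDim_of_isRegular rs hrs
  have h2 := Module.supportDim_le_ringKrullDim R M
  have h3 : Nontrivial (M ⧸ Ideal.ofList rs • (⊤ : Submodule R M)) :=
    Submodule.Quotient.nontrivial_iff.2 hrs.top_ne_smul.symm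
  have h4 := Module.supportDim_ne_bot_of_nontrivial R (M ⧸ Ideal.ofList rs • (⊤ : Submodule R M))
  obtain ⟨a, ha⟩ := WithBot.ne_bot_iff_exists.1 h4
  rw [hd, ← h1, ← ha] at h2
  have h5 : a + (rs.length : ℕ∞) ≤ (d : ℕ∞) := by exact_mod_cast h2
  have h6 : (rs.length : ℕ∞) ≤ d := le_trans le_add_self h5
  refine ⟨by exact_mod_cast h6, fun h => ?_⟩
  rw [← h1, ← ha]
  have h7 : (d : ℕ∞) ≤ rs.length := by exact_mod_cast h
  have h8 : a + (rs.length : ℕ∞) = d := le_antisymm h5 (h7.trans le_add_self)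
  exact_mod_cast congrArg (WithBot.some) h8

/-- A nonzero module is Cohen-Macaulay if and only if it has a regular sequence of
length `dim R`. -/
lemma isCohenMacaulay_iff_exists (hd : ringKrullDim R = d) {M : Type u} [AddCommGroup M]
    [Module R M] [Module.Finite R M] [Nontrivial M] :
    IsCohenMacaulay R M ↔ ∃ rs : List R, rs.length = d ∧ (∀ r ∈ rs, r ∈ maximalIdeal R) ∧
      RingTheory.Sequence.IsRegular M rs := by
  have htop : (⊤ : Submodule R M) ≠ maximalIdeal R • ⊤ :=
    Submodule.top_ne_ideal_smul_of_le_jacobson_annihilator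
      ((maximalIdeal_le_jacobson _))
  constructor
  · rintro (h | ⟨-, h⟩)
    · exact absurd h (not_subsingleton M)
    rw [hd] at h
    have h' : depth R M = d := by exact_mod_cast h
    by_contra hne
    push Not at hne
    have hlt : ∀ rs : {rs : List R // (∀ r ∈ rs, r ∈ maximalIdeal R) ∧
        RingTheory.Sequence.IsRegular M rs}, rs.1.length < d := fun rs =>
      lt_of_le_of_ne (length_le_of_isRegular hd rs.2.2).1
        fun h => hne _ h rs.2.1 rs.2.2
    have h0 := hlt ⟨[], by simp, ⟨RingTheory.Sequence.IsWeaklyRegular.nil R M, by simp⟩⟩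
    have h2 : depth R M ≤ ((d - 1 : ℕ) : ℕ∞) := iSup_le fun rs => by
      have := hlt rs
      exact_mod_cast (by omega : rs.1.length ≤ d - 1)
    rw [h'] at h2
    have : d ≤ d - 1 := by exact_mod_cast h2
    simp at h0
    omega
  · rintro ⟨rs, hl, hm, hrs⟩
    refine Or.inr ⟨hd ▸ (length_le_of_isRegular hd hrs).2 hl.ge, ?_⟩
    have h' : depth R M = d := by
      refine le_antisymm (iSup_le fun rs => ?_) ?_
      · exact_mod_cast (length_le_of_isRegular hd rs.2.2).1
      · rw [← hl]
        exact le_iSup (fun rs : {rs : List R // (∀ r ∈ rs, r ∈ maximalIdeal R) ∧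
          RingTheory.Sequence.IsRegular M rs} => (rs.1.length : ℕ∞)) ⟨rs, hm, hrs⟩
    rw [hd, h']
    rfl

/-- By Rees' theorem, a finitely generated module is Cohen-Macaulay if and only if `Ext^i(k, M)`
vanishes for `i < dim R`. -/
lemma isCohenMacaulay_iff (hd : ringKrullDim R = d) {M : Type u} [AddCommGroup M]
    [Module R M] [Module.Finite R M] :
    IsCohenMacaulay R M ↔ ∀ i < d, Subsingleton
      (Abelian.Ext (ModuleCat.of R (R ⧸ maximalIdeal R)) (ModuleCat.of R M) i) := by
  rcases subsingleton_or_nontrivial M with h | h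
  · refine ⟨fun _ i _ => ⟨fun x y => ?_⟩, fun _ => Or.inl h⟩
    have h0 : 𝟙 (ModuleCat.of R M) = 0 := by
      ext x
      exact Subsingleton.elim _ _
    rw [← x.comp_mk₀_id, ← y.comp_mk₀_id, h0]
    simp
  have hlt : maximalIdeal R • (⊤ : Submodule R M) < ⊤ :=
    lt_top_iff_ne_top.2 (Submodule.top_ne_ideal_smul_of_le_jacobson_annihilator
      ((maximalIdeal_le_jacobson _))).symm
  have hsupp : Module.support R (R ⧸ maximalIdeal R)
      = PrimeSpectrum.zeroLocus (maximalIdeal R) := by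
    rw [Module.support_eq_zeroLocus, Ideal.annihilator_quotient]
  rw [isCohenMacaulay_iff_exists hd]
  constructor
  · rintro ⟨rs, rfl, hm, hrs⟩
    exact ModuleCat.subsingleton_ext_of_exists_isRegular (maximalIdeal R)
      (ModuleCat.of R (R ⧸ maximalIdeal R)) hsupp.subset (ModuleCat.of R M) hlt rs hm hrs
  · intro h
    exact ModuleCat.exists_isRegular_of_exists_subsingleton_ext (maximalIdeal R) d
      (ModuleCat.of R M) hlt (ModuleCat.of R (R ⧸ maximalIdeal R)) hsupp h

variable {K E M : Type u} [AddCommGroup K] [Module R K] [Module.Finite R K] [AddCommGroup E]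
  [Module R E] [Module.Finite R E] [AddCommGroup M] [Module R M] [Module.Finite R M]

/-- The short exact sequence of modules given by an injective map, a surjective map, and
exactness in the middle. -/
lemma shortExact_of_exact {B : Type*} [Ring B] {K E M : Type u} [AddCommGroup K] [Module B K]
    [AddCommGroup E] [Module B E] [AddCommGroup M] [Module B M]
    {i : K →ₗ[B] E} {p : E →ₗ[B] M} (hi : Function.Injective i) (hex : Function.Exact i p)
    (hp : Function.Surjective p) :
    (ShortComplex.mk (ModuleCat.ofHom i) (ModuleCat.ofHom p)
      (ModuleCat.hom_ext hex.linearMap_comp_eq_zero)).ShortExact :=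
  ModuleCat.shortComplex_shortExact _ hex hi hp

lemma IsCohenMacaulay.of_extension (hd : ringKrullDim R = d) {i : K →ₗ[R] E} {p : E →ₗ[R] M}
    (hi : Function.Injective i) (hex : Function.Exact i p) (hp : Function.Surjective p)
    (hK : IsCohenMacaulay R K) (hM : IsCohenMacaulay R M) : IsCohenMacaulay R E := by
  rw [isCohenMacaulay_iff hd] at *
  intro j hj
  have := hK j hj
  have := hM j hj
  refine subsingleton_of_forall_eq 0 fun x => ?_
  obtain ⟨y, rfl⟩ := Abelian.Ext.covariant_sequence_exact₂ _ (shortExact_of_exact hi hex hp) x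
    (Subsingleton.elim (h := hM j hj) _ _)
  have hy : y = 0 := Subsingleton.elim (h := hK j hj) _ _
  rw [hy]
  simp

lemma IsCohenMacaulay.of_kernel (hd : ringKrullDim R = d) {i : K →ₗ[R] E} {p : E →ₗ[R] M}
    (hi : Function.Injective i) (hex : Function.Exact i p) (hp : Function.Surjective p)
    (hE : IsCohenMacaulay R E) (hM : IsCohenMacaulay R M) : IsCohenMacaulay R K := by
  rw [isCohenMacaulay_iff hd] at *
  intro j hj
  refine subsingleton_of_forall_eq 0 fun x => ?_
  cases j with
  | zero =>
    have hS := shortExact_of_exact hi hex hp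
    have := hS.mono_f
    exact Abelian.Ext.postcomp_mk₀_injective_of_mono _ (ModuleCat.ofHom i)
      (Subsingleton.elim (h := hE 0 hj) _ _)
  | succ j =>
    obtain ⟨y, rfl⟩ := Abelian.Ext.covariant_sequence_exact₁ _ (shortExact_of_exact hi hex hp) x
      (Subsingleton.elim (h := hE _ hj) _ _) rfl
    have hy : y = 0 := Subsingleton.elim (h := hM j (by omega)) _ _
    rw [hy]
    simp

/-- A module whose identity is a sum of maps factoring through a Cohen-Macaulay module is
Cohen-Macaulay. -/
lemma IsCohenMacaulay.of_sum (hd : ringKrullDim R = d) {ι : Type*} [Fintype ι]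
    (a : ι → M →ₗ[R] E) (b : ι → E →ₗ[R] M) (hab : ∀ x, ∑ i, b i (a i x) = x)
    (hE : IsCohenMacaulay R E) : IsCohenMacaulay R M := by
  rw [isCohenMacaulay_iff hd] at *
  intro j hj
  refine subsingleton_of_forall_eq 0 fun x => ?_
  have h1 : 𝟙 (ModuleCat.of R M) = ∑ i, ModuleCat.ofHom (a i) ≫ ModuleCat.ofHom (b i) := by
    ext y
    simp [ModuleCat.hom_sum, hab]
  have h2 : (x.comp (Abelian.Ext.mk₀ (𝟙 (ModuleCat.of R M))) (add_zero j)) = 0 := by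
    rw [h1, Abelian.Ext.mk₀_sum, Abelian.Ext.comp_sum]
    refine Finset.sum_eq_zero fun i _ => ?_
    rw [← Abelian.Ext.mk₀_comp_mk₀, ← Abelian.Ext.comp_assoc_of_second_deg_zero]
    have h3 : x.comp (Abelian.Ext.mk₀ (ModuleCat.ofHom (a i))) (add_zero j) = 0 :=
      Subsingleton.elim (h := hE j hj) _ _
    rw [h3]
    simp
  rwa [Abelian.Ext.comp_mk₀_id] at h2

end CM

section CMObj

variable {R : Type u} [CommRing R] [IsLocalRing R] [IsNoetherianRing R] {d : ℕ}
  {B : Type u} [Ring B] [Algebra R B] [Module.Finite R B] {K E M : FGModuleCat.{u} B}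

lemma IsCMObj.of_extension (hd : ringKrullDim R = d) {i : K →ₗ[B] E} {p : E →ₗ[B] M}
    (hi : Function.Injective i) (hex : Function.Exact i p) (hp : Function.Surjective p)
    (hK : IsCMObj R K) (hM : IsCMObj R M) : IsCMObj R E := by
  let m1 : Module R K := Module.restrictScalars R B K
  let m2 : Module R E := Module.restrictScalars R B E
  let m3 : Module R M := Module.restrictScalars R B M
  have : IsScalarTower R B K := IsScalarTower.of_algebraMap_smul fun _ _ => rfl
  have : IsScalarTower R B E := IsScalarTower.of_algebraMap_smul fun _ _ => rfl
  have : IsScalarTower R B M := IsScalarTower.of_algebraMap_smul fun _ _ => rfl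
  have : Module.Finite R K := Module.Finite.trans B K
  have : Module.Finite R E := Module.Finite.trans B E
  have : Module.Finite R M := Module.Finite.trans B M
  exact IsCohenMacaulay.of_extension hd (i := i.restrictScalars R) (p := p.restrictScalars R)
    hi hex hp hK hM

lemma IsCMObj.of_kernel (hd : ringKrullDim R = d) {i : K →ₗ[B] E} {p : E →ₗ[B] M}
    (hi : Function.Injective i) (hex : Function.Exact i p) (hp : Function.Surjective p)
    (hE : IsCMObj R E) (hM : IsCMObj R M) : IsCMObj R K := by
  let m1 : Module R K := Module.restrictScalars R B K
  let m2 : Module R E := Module.restrictScalars R B E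
  let m3 : Module R M := Module.restrictScalars R B M
  have : IsScalarTower R B K := IsScalarTower.of_algebraMap_smul fun _ _ => rfl
  have : IsScalarTower R B E := IsScalarTower.of_algebraMap_smul fun _ _ => rfl
  have : IsScalarTower R B M := IsScalarTower.of_algebraMap_smul fun _ _ => rfl
  have : Module.Finite R K := Module.Finite.trans B K
  have : Module.Finite R E := Module.Finite.trans B E
  have : Module.Finite R M := Module.Finite.trans B M
  exact IsCohenMacaulay.of_kernel hd (i := i.restrictScalars R) (p := p.restrictScalars R)
    hi hex hp hE hM

lemma IsCMObj.of_sum (hd : ringKrullDim R = d) {ι : Type*} [Fintype ι] (a : ι → M →ₗ[B] E)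
    (b : ι → E →ₗ[B] M) (hab : ∀ x, ∑ i, b i (a i x) = x) (hE : IsCMObj R E) : IsCMObj R M := by
  let m2 : Module R E := Module.restrictScalars R B E
  let m3 : Module R M := Module.restrictScalars R B M
  have : IsScalarTower R B E := IsScalarTower.of_algebraMap_smul fun _ _ => rfl
  have : IsScalarTower R B M := IsScalarTower.of_algebraMap_smul fun _ _ => rfl
  have : Module.Finite R E := Module.Finite.trans B E
  have : Module.Finite R M := Module.Finite.trans B M
  exact IsCohenMacaulay.of_sum hd (E := E) (fun i => (a i).restrictScalars R)
    (fun i => (b i).restrictScalars R) hab hE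

/-- Finitely generated projective modules over an order are Cohen-Macaulay. -/
lemma IsCMObj.of_projective (hd : ringKrullDim R = d) (hB : IsCMObj R (FGModuleCat.of B B))
    (hM : Module.Projective B M) : IsCMObj R M := by
  obtain ⟨n, f, hf⟩ := Module.Finite.exists_fin' B M
  obtain ⟨g, hg⟩ := Module.projective_lifting_property f LinearMap.id hf
  refine IsCMObj.of_sum hd (E := FGModuleCat.of B B) (fun i : Fin n => LinearMap.proj i ∘ₗ g)
    (fun i => f ∘ₗ LinearMap.single B (fun _ => B) i) (fun x => ?_) hB
  have h1 : f (∑ i, Pi.single i (g x i)) = x := by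
    rw [Finset.univ_sum_single]
    exact LinearMap.congr_fun hg x
  rw [map_sum] at h1
  exact h1

lemma IsCMObj.syz (hd : ringKrullDim R = d) (hB : IsCMObj R (FGModuleCat.of B B))
    (hM : IsCMObj R M) : IsCMObj R (syz R M) :=
  .of_kernel hd syzIncl_injective (syz_exact R M) (cover M).surjective
    (.of_projective hd hB (cover M).projective) hM

lemma IsCMObj.syzPow (hd : ringKrullDim R = d) (hB : IsCMObj R (FGModuleCat.of B B))
    (hM : IsCMObj R M) (n : ℕ) : IsCMObj R (syzPow R n M) := by
  induction n with
  | zero => exact hM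
  | succ n ih =>
    rw [syzPow_succ']
    exact IsCMObj.syz hd hB ih

/-- An order `A` is Cohen-Macaulay as a right module over itself. -/
lemma isCMObj_right_regular (hd : ringKrullDim R = d) {A : Type u} [Ring A] [Algebra R A]
    [Module.Finite R A] (hA : IsCohenMacaulay R A) : IsCMObj R (FGModuleCat.of Aᵐᵒᵖ Aᵐᵒᵖ) := by
  let e : A ≃ₗ[R] Aᵐᵒᵖ := MulOpposite.opLinearEquiv R
  have h : IsCohenMacaulay R Aᵐᵒᵖ := IsCohenMacaulay.of_sum hd (E := A) (ι := Unit)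
    (fun _ => e.symm.toLinearMap) (fun _ => e.toLinearMap) (fun x => by simp) hA
  have : Module.restrictScalars R Aᵐᵒᵖ (FGModuleCat.of Aᵐᵒᵖ Aᵐᵒᵖ)
      = (inferInstance : Module R Aᵐᵒᵖ) := by
    ext r a
    exact (Algebra.smul_def r a).symm
  unfold IsCMObj
  rw [this]
  exact h

end CMObj

/-! ### Vanishing of Ext in terms of syzygies -/

section ExtVan

variable (R : Type u) [CommRing R] [IsNoetherianRing R] {B : Type u} [Ring B] [Algebra R B]
  [Module.Finite R B]

/-- `Ext^1_B(M, C) = 0`, expressed through the projective cover `P` of `M`: every map `Ω M → C`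
extends to `P`. -/
def SyzygyMapsExtend (C : Type u) [AddCommGroup C] [Module B C] (M : FGModuleCat.{u} B) : Prop :=
  ∀ h : syz R M →ₗ[B] C, ∃ g : (cover M).P →ₗ[B] C, g ∘ₗ syzIncl R M = h

variable {R}

lemma SyzygyMapsExtend.congr {C C' : Type u} [AddCommGroup C] [Module B C] [AddCommGroup C']
    [Module B C'] (e : C ≃ₗ[B] C') {M : FGModuleCat.{u} B} (h : SyzygyMapsExtend R C M) :
    SyzygyMapsExtend R C' M := fun f => by
  obtain ⟨g, hg⟩ := h (e.symm.toLinearMap ∘ₗ f)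
  exact ⟨e.toLinearMap ∘ₗ g, by rw [LinearMap.comp_assoc, hg]; ext; simp⟩

lemma syz_shortExact (M : FGModuleCat.{u} B) :
    (ShortComplex.mk (ModuleCat.ofHom (syzIncl R M)) (ModuleCat.ofHom (cover M).π)
      (ModuleCat.hom_ext (syz_exact R M).linearMap_comp_eq_zero)).ShortExact :=
  shortExact_of_exact syzIncl_injective (syz_exact R M) (cover M).surjective

instance (M : FGModuleCat.{u} B) : Projective (ModuleCat.of B (cover M).P) :=
  have := (cover M).projective
  ModuleCat.projective_of_categoryTheory_projective _

variable (C : Type u) [AddCommGroup C] [Module B C]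

omit [Module.Finite R B] [Algebra R B] [IsNoetherianRing R] [CommRing R] in
/-- `Ext^1` computed by an arbitrary projective presentation. -/
lemma subsingleton_ext_one_iff_of_exact {K P M : Type u} [AddCommGroup K] [Module B K]
    [AddCommGroup P] [Module B P] [AddCommGroup M] [Module B M] [Module.Projective B P]
    {i : K →ₗ[B] P} {p : P →ₗ[B] M} (hi : Function.Injective i) (hex : Function.Exact i p)
    (hp : Function.Surjective p) :
    Subsingleton (Abelian.Ext (ModuleCat.of B M) (ModuleCat.of B C) 1) ↔
      ∀ h : K →ₗ[B] C, ∃ g : P →ₗ[B] C, g ∘ₗ i = h := by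
  have hS := shortExact_of_exact hi hex hp
  have hP : Projective (ModuleCat.of B P) := ModuleCat.projective_of_categoryTheory_projective _
  constructor
  · intro hs h
    obtain ⟨y, hy⟩ := Abelian.Ext.contravariant_sequence_exact₁ hS _
      (Abelian.Ext.mk₀ (ModuleCat.ofHom h)) rfl (Subsingleton.elim (h := hs) _ _)
    obtain ⟨g, rfl⟩ := Abelian.Ext.homEquiv₀.symm.surjective y
    refine ⟨g.hom, ?_⟩
    have h1 : ModuleCat.ofHom i ≫ g = ModuleCat.ofHom h :=
      Abelian.Ext.homEquiv₀.symm.injective (by simpa using hy)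
    exact congrArg ModuleCat.Hom.hom h1
  · intro he
    refine subsingleton_of_forall_eq 0 fun x => ?_
    obtain ⟨y, rfl⟩ := Abelian.Ext.contravariant_sequence_exact₃ hS _ x
      (Abelian.Ext.eq_zero_of_projective (P := ModuleCat.of B P) _) (add_zero 1)
    obtain ⟨h, rfl⟩ := Abelian.Ext.homEquiv₀.symm.surjective y
    obtain ⟨g, hg⟩ := he h.hom
    have h1 : h = ModuleCat.ofHom i ≫ ModuleCat.ofHom g := by
      ext1
      exact hg.symm
    rw [h1]
    simp only [Abelian.Ext.homEquiv₀_symm_apply, ← Abelian.Ext.mk₀_comp_mk₀]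
    exact hS.extClass_comp_assoc _

lemma subsingleton_ext_one_iff (M : FGModuleCat.{u} B) :
    Subsingleton (Abelian.Ext (ModuleCat.of B M) (ModuleCat.of B C) 1) ↔
      SyzygyMapsExtend R C M :=
  have := (cover M).projective
  subsingleton_ext_one_iff_of_exact C syzIncl_injective (syz_exact R M) (cover M).surjective

lemma subsingleton_ext_succ_iff (M : FGModuleCat.{u} B) (n : ℕ) :
    Subsingleton (Abelian.Ext (ModuleCat.of B M) (ModuleCat.of B C) (n + 1 + 1)) ↔
      Subsingleton (Abelian.Ext (ModuleCat.of B (syz R M)) (ModuleCat.of B C) (n + 1)) := by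
  have hS := syz_shortExact (R := R) M
  constructor
  · intro hs
    refine subsingleton_of_forall_eq 0 fun x => ?_
    obtain ⟨y, rfl⟩ := Abelian.Ext.contravariant_sequence_exact₁ hS _ x (add_comm _ _)
      (Subsingleton.elim (h := hs) _ _)
    rw [Abelian.Ext.eq_zero_of_projective (P := ModuleCat.of B (cover M).P) y]
    simp
  · intro hs
    refine subsingleton_of_forall_eq 0 fun x => ?_
    obtain ⟨y, rfl⟩ := Abelian.Ext.contravariant_sequence_exact₃ hS _ x
      (Abelian.Ext.eq_zero_of_projective (P := ModuleCat.of B (cover M).P) _) (add_comm 1 (n + 1))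
    have hy : y = 0 := Subsingleton.elim (h := hs) _ _
    rw [hy]
    simp

/-- Dimension shifting. -/
lemma subsingleton_ext_iff (M : FGModuleCat.{u} B) (n : ℕ) :
    Subsingleton (Abelian.Ext M.obj (ModuleCat.of B C) (n + 1)) ↔
      SyzygyMapsExtend R C (syzPow R n M) := by
  induction n generalizing M with
  | zero => exact subsingleton_ext_one_iff C M
  | succ n ih => exact (subsingleton_ext_succ_iff (R := R) C M n).trans (ih (syz R M))

variable {C}

/-- The vanishing of `Ext^1` is invariant under stable isomorphism. -/
lemma SyzygyMapsExtend.of_stablyIso {M N : FGModuleCat.{u} B} (h : StablyIso M N)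
    (hN : SyzygyMapsExtend R C N) : SyzygyMapsExtend R C M := by
  rw [← subsingleton_ext_one_iff] at hN ⊢
  obtain ⟨f, g, ⟨Q, hQ, a, b, hab⟩, -⟩ := h
  have hQ' : Projective (ModuleCat.of B Q) := ModuleCat.projective_of_categoryTheory_projective _
  refine subsingleton_of_forall_eq 0 fun x => ?_
  have h1 : 𝟙 (ModuleCat.of B M) = ModuleCat.ofHom f ≫ ModuleCat.ofHom g
      - ModuleCat.ofHom a ≫ ModuleCat.ofHom b := by
    ext1
    change LinearMap.id = g ∘ₗ f - b ∘ₗ a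
    rw [← hab]
    abel
  have h2 : (Abelian.Ext.mk₀ (ModuleCat.ofHom g)).comp x (zero_add 1) = 0 :=
    Subsingleton.elim (h := hN) _ _
  have h3 : (Abelian.Ext.mk₀ (ModuleCat.ofHom b)).comp x (zero_add 1) = 0 :=
    Abelian.Ext.eq_zero_of_projective (P := ModuleCat.of B Q) _
  rw [← Abelian.Ext.mk₀_id_comp x, h1, sub_eq_add_neg, Abelian.Ext.mk₀_add, Abelian.Ext.mk₀_neg,
    Abelian.Ext.add_comp, Abelian.Ext.neg_comp, ← Abelian.Ext.mk₀_comp_mk₀_assoc, h2,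
    ← Abelian.Ext.mk₀_comp_mk₀_assoc, h3]
  simp

/-- If `Ext^1(M, B) = 0`, maps from `Ω M` to finitely generated projectives extend to the
projective cover of `M`. -/
lemma SyzygyMapsExtend.to_projective {M : FGModuleCat.{u} B} (hM : SyzygyMapsExtend R B M)
    {Q : Type u} [AddCommGroup Q] [Module B Q] [Module.Finite B Q] [Module.Projective B Q] :
    SyzygyMapsExtend R Q M := by
  intro a
  obtain ⟨n, f, hf⟩ := Module.Finite.exists_fin' B Q
  obtain ⟨s, hs⟩ := Module.projective_lifting_property f LinearMap.id hf
  choose g hg using fun i : Fin n => hM (LinearMap.proj i ∘ₗ s ∘ₗ a)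
  refine ⟨f ∘ₗ LinearMap.pi g, ?_⟩
  have h1 : LinearMap.pi g ∘ₗ syzIncl R M = s ∘ₗ a := by
    ext x i
    exact LinearMap.congr_fun (hg i) x
  rw [LinearMap.comp_assoc, h1, ← LinearMap.comp_assoc, hs, LinearMap.id_comp]

/-- If `Ext^1(M, B) = 0`, a projective summand of `Ω M` would be a summand of the projective
cover of `M`, which is impossible as `Ω M` is superfluous there. -/
lemma SyzygyMapsExtend.hasNoProjectiveSummand {M : FGModuleCat.{u} B}
    (hM : SyzygyMapsExtend R B M) (hc : (cover M).IsCover) :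
    HasNoProjectiveSummand (syz R M) := by
  rintro e he ⟨Q, hQ, a, b, rfl⟩
  obtain ⟨a', ha'⟩ := hM.to_projective (a ∘ₗ b ∘ₗ a)
  have he' : ∀ x, b (a (b (a x))) = b (a x) := fun x => LinearMap.congr_fun he x
  have ha'' : ∀ x, a' (syzIncl R M x) = a (b (a x)) := fun x => LinearMap.congr_fun ha' x
  -- `t` is an idempotent of the projective cover with image in `Ω M`, hence zero
  let t : (cover M).P →ₗ[B] (cover M).P := syzIncl R M ∘ₗ b ∘ₗ a ∘ₗ b ∘ₗ a'
  have ht : ∀ x, t (syzIncl R M x) = syzIncl R M (b (a x)) := fun x => by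
    simp only [t, LinearMap.comp_apply, ha'', he']
  have htt : ∀ x, t (t x) = t x := fun x => by
    change t (syzIncl R M (b (a (b (a' x))))) = _
    rw [ht, he']
    rfl
  have htop : LinearMap.range (LinearMap.id - t) = ⊤ := by
    refine hc _ (eq_top_iff.2 fun x _ => ?_)
    refine Submodule.mem_sup.2 ⟨x - t x, ⟨x, rfl⟩, t x, ?_, by abel⟩
    exact cover_π_syzIncl _
  ext x
  apply syzIncl_injective
  obtain ⟨y, hy⟩ := LinearMap.range_eq_top.1 htop (syzIncl R M x)
  change syzIncl R M (b (a x)) = syzIncl R M 0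
  rw [← ht, ← hy]
  simp [htt]

end ExtVan

/-! ### Periodicity forces the vanishing of Ext -/

section Periodic

variable {B : Type u} [Ring B]

lemma isIso_functor_map {M N : FGModuleCat.{u} B} {f : M →ₗ[B] N} {g : N →ₗ[B] M}
    (h1 : FactorsThroughProjective B (g ∘ₗ f - LinearMap.id))
    (h2 : FactorsThroughProjective B (f ∘ₗ g - LinearMap.id)) :
    IsIso ((Quotient.functor (stableRel B)).map (fgHom f)) := by
  refine ⟨(Quotient.functor (stableRel B)).map (fgHom g), ?_, ?_⟩
  · rw [← CategoryTheory.Functor.map_comp, ← CategoryTheory.Functor.map_id]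
    exact CategoryTheory.Quotient.sound _ h1
  · rw [← CategoryTheory.Functor.map_comp, ← CategoryTheory.Functor.map_id]
    exact CategoryTheory.Quotient.sound _ h2

/-- An isomorphism of the stable category comes from a stable inverse. -/
lemma exists_stable_inverse_of_isIso {M N : FGModuleCat.{u} B} {f : M ⟶ N}
    (h : IsIso ((Quotient.functor (stableRel B)).map f)) :
    ∃ g : N →ₗ[B] M, FactorsThroughProjective B (g ∘ₗ f.hom.hom - LinearMap.id) ∧
      FactorsThroughProjective B (f.hom.hom ∘ₗ g - LinearMap.id) := by
  obtain ⟨g', h1, h2⟩ := h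
  obtain ⟨g, rfl⟩ := (Quotient.functor (stableRel B)).map_surjective g'
  rw [← CategoryTheory.Functor.map_comp, ← CategoryTheory.Functor.map_id] at h1 h2
  exact ⟨g.hom.hom, (Quotient.functor_map_eq_iff (stableRel B) _ _).1 h1,
    (Quotient.functor_map_eq_iff (stableRel B) _ _).1 h2⟩

/-- If `p` is surjective and a stable isomorphism, it splits. -/
lemma exists_section_of_factorsThroughProjective {E M : Type u} [AddCommGroup E] [Module B E]
    [AddCommGroup M] [Module B M] {p : E →ₗ[B] M} (hp : Function.Surjective p) {s : M →ₗ[B] E}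
    (hs : FactorsThroughProjective B (p ∘ₗ s - LinearMap.id)) :
    ∃ σ : M →ₗ[B] E, p ∘ₗ σ = LinearMap.id := by
  obtain ⟨Q, hQ, a, b, hab⟩ := hs
  obtain ⟨b', hb'⟩ := Module.projective_lifting_property p b hp
  refine ⟨s - b' ∘ₗ a, ?_⟩
  rw [LinearMap.comp_sub, ← LinearMap.comp_assoc, hb', ← hab]
  abel

variable {R : Type u} [CommRing R] [IsNoetherianRing R] [Algebra R B] [Module.Finite R B]

lemma isIso_omega_map {M N : FGModuleCat.{u} B} {f : M →ₗ[B] N} {u : syz R M →ₗ[B] syz R N}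
    (hu : IsSyzMap R f u) (h : IsIso ((Quotient.functor (stableRel B)).map (fgHom u))) :
    IsIso ((Omega R B).map ((Quotient.functor (stableRel B)).map (fgHom f))) := by
  have h1 : (Omega R B).map ((Quotient.functor (stableRel B)).map (fgHom f))
      = (Quotient.functor (stableRel B)).map (fgHom u) := by
    refine CategoryTheory.Quotient.sound _ ?_
    have H := (exists_isSyzMap (R := R) (fgHom f).hom.hom).choose_spec
    refine (H.sub hu).factors ?_
    change FactorsThroughProjective B (f - f)
    rw [sub_self]
    exact FactorsThroughProjective.zero
  rw [h1]
  exact h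

lemma isIso_omegaPow_map {M N : StableCat B} {f : M ⟶ N} (hf : IsIso ((Omega R B).map f)) (n : ℕ) :
    IsIso ((OmegaPow R B (n + 1)).map f) := by
  induction n with
  | zero => exact hf
  | succ n ih => exact Functor.map_isIso (Omega R B) ((OmegaPow R B (n + 1)).map f)

lemma omegaPow_obj (n : ℕ) (M : FGModuleCat.{u} B) :
    (OmegaPow R B n).obj ((Quotient.functor (stableRel B)).obj M)
      = (Quotient.functor (stableRel B)).obj (syzPow R n M) := by
  induction n with
  | zero => rfl
  | succ n ih =>
    rw [syzPow_succ']
    change (Omega R B).obj ((OmegaPow R B n).obj _) = _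
    rw [ih]
    rfl

lemma stablyIso_of_iso {M N : FGModuleCat.{u} B}
    (e : (Quotient.functor (stableRel B)).obj M ≅ (Quotient.functor (stableRel B)).obj N) :
    StablyIso M N := by
  obtain ⟨f, hf⟩ := (Quotient.functor (stableRel B)).map_surjective e.hom
  obtain ⟨g, h1, h2⟩ := exists_stable_inverse_of_isIso (f := f) (hf ▸ inferInstance)
  exact ⟨f.hom.hom, g, h1, h2⟩

variable [IsLocalRing R] {l : ℕ} (η : (stableCM R B).ι ⋙ OmegaPow R B l ≅ (stableCM R B).ι)

include η in
lemma stablyIso_syzPow {M : FGModuleCat.{u} B} (hM : IsCMObj R M) :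
    StablyIso (syzPow R l M) M := by
  have e := η.app ⟨(Quotient.functor (stableRel B)).obj M, hM⟩
  exact stablyIso_of_iso ((eqToIso (omegaPow_obj l M).symm).trans e)

include η in
/-- Periodicity of positive period makes `Ω` detect isomorphisms between Cohen-Macaulay modules. -/
lemma isIso_of_isIso_omega (hl : 0 < l) {M N : FGModuleCat.{u} B} (hM : IsCMObj R M)
    (hN : IsCMObj R N) {f : M ⟶ N}
    (hf : IsIso ((Omega R B).map ((Quotient.functor (stableRel B)).map f))) :
    IsIso ((Quotient.functor (stableRel B)).map f) := by
  obtain ⟨n, rfl⟩ : ∃ n, l = n + 1 := ⟨l - 1, by omega⟩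
  let M' : (stableCM R B).FullSubcategory := ⟨(Quotient.functor (stableRel B)).obj M, hM⟩
  let N' : (stableCM R B).FullSubcategory := ⟨(Quotient.functor (stableRel B)).obj N, hN⟩
  let f' : M' ⟶ N' := ObjectProperty.homMk ((Quotient.functor (stableRel B)).map f)
  have h1 : IsIso (((stableCM R B).ι ⋙ OmegaPow R B (n + 1)).map f') := isIso_omegaPow_map hf n
  exact (NatIso.isIso_map_iff η f').1 h1

include η in
/-- Over a periodic order of positive period, `Ext^1(M, B)` vanishes for Cohen-Macaulay `M`:
the projection `E → M` of an extension of `M` by `B` becomes a stable isomorphism under `Ω`, hence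
is one itself, hence splits. -/
lemma syzygyMapsExtend_of_periodic {d : ℕ} (hd : ringKrullDim R = d) (hl : 0 < l)
    (hB : IsCMObj R (FGModuleCat.of B B)) {M : FGModuleCat.{u} B} (hM : IsCMObj R M) :
    SyzygyMapsExtend R B M := by
  intro h
  have := (cover M).projective
  -- `E` is the pushout of `h` and the inclusion of `Ω M` in the projective cover `P`
  let j : syz R M →ₗ[B] (B × (cover M).P) := (-h).prod (syzIncl R M)
  have hj : Function.Injective j := fun x y hxy => syzIncl_injective (congrArg Prod.snd hxy)
  let E : FGModuleCat.{u} B := FGModuleCat.of B ((B × (cover M).P) ⧸ LinearMap.range j)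
  let q : (B × (cover M).P) →ₗ[B] E := (LinearMap.range j).mkQ
  have hq : Function.Surjective q := Submodule.mkQ_surjective _
  have hjq : Function.Exact j q := LinearMap.exact_map_mkQ_range j
  let i : FGModuleCat.of B B →ₗ[B] E := q ∘ₗ LinearMap.inl B B (cover M).P
  let p : E →ₗ[B] M := (LinearMap.range j).liftQ ((cover M).π ∘ₗ LinearMap.snd B B (cover M).P) (by
    rintro _ ⟨x, rfl⟩
    exact cover_π_syzIncl x)
  have hpq : ∀ x, p (q x) = (cover M).π x.2 := fun x => rfl
  have hp : Function.Surjective p := fun m => by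
    obtain ⟨x, rfl⟩ := (cover M).surjective m
    exact ⟨q (0, x), rfl⟩
  have hi : Function.Injective i := by
    rw [← LinearMap.ker_eq_bot, LinearMap.ker_eq_bot']
    intro b hb
    obtain ⟨k, hk⟩ := (hjq _).1 hb
    have hk0 : k = 0 := syzIncl_injective ((congrArg Prod.snd hk).trans (map_zero _).symm)
    rw [hk0, map_zero] at hk
    exact (congrArg Prod.fst hk).symm
  have hip : Function.Exact i p := by
    intro x
    obtain ⟨⟨b, y⟩, rfl⟩ := hq x
    constructor
    · intro hx
      obtain ⟨k, rfl⟩ := (syz_exact R M y).1 hx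
      refine ⟨b + h k, ?_⟩
      have h1 : q (j k) = 0 := (hjq _).2 ⟨k, rfl⟩
      change q (b + h k, 0) = q (b, syzIncl R M k)
      rw [← add_zero (q (b + h k, 0)), ← h1, ← map_add]
      simp [j]
    · rintro ⟨c, hc⟩
      rw [← hc]
      exact (hpq _).trans (map_zero _)
  have hE : IsCMObj R E := hB.of_extension hd hi hip hp hM
  have := (cover E).projective
  -- `0 → Ω M → B × P → E → 0` computes `Ω E`, so `Ω p` is a stable isomorphism
  obtain ⟨w, v, hvw, hwv, α, hα, hwα⟩ := exists_stable_inverse (syzIncl_injective (R := R) (M := E))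
    (syz_exact R E) (cover E).surjective hj hjq hq
  have hw : IsSyzMap R p w := by
    refine ⟨LinearMap.snd B B (cover M).P ∘ₗ α, ?_, ?_⟩
    · ext x
      exact congrArg p (LinearMap.congr_fun hα x)
    · ext x
      exact congrArg Prod.snd (LinearMap.congr_fun hwα x)
  have hiso := isIso_of_isIso_omega η hl hE hM (isIso_omega_map hw (isIso_functor_map hvw hwv))
  obtain ⟨s, -, hs⟩ := exists_stable_inverse_of_isIso hiso
  obtain ⟨σ, hσ⟩ := exists_section_of_factorsThroughProjective hp hs
  obtain ⟨r, hr⟩ := exists_lift_of_exact hi hip (LinearMap.id - σ ∘ₗ p) (by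
    rw [LinearMap.comp_sub, ← LinearMap.comp_assoc, hσ, LinearMap.id_comp, LinearMap.comp_id,
      sub_self])
  -- the retraction `r` of `i`, restricted to `P`, extends `h`
  refine ⟨r ∘ₗ q ∘ₗ LinearMap.inr B B (cover M).P, ?_⟩
  ext k
  apply hi
  have h1 : q (0, syzIncl R M k) = i (h k) := by
    have h2 : q (j k) = 0 := (hjq _).2 ⟨k, rfl⟩
    change _ = q (h k, 0)
    rw [← sub_eq_zero, ← map_sub, ← h2]
    congr 1
    simp [j]
  have h3 := LinearMap.congr_fun hr (i (h k))
  have h4 : p (i (h k)) = 0 := (hip _).2 ⟨_, rfl⟩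
  change i (r (q (0, syzIncl R M k))) = i (h k)
  rw [h1]
  simpa [h4] using h3

end Periodic

/-! ### Duals and reflexive modules -/

section Dual

variable {A : Type u} [Ring A]

/-- A map vanishing on the kernel of a surjection `π` descends along `π`. -/
lemma exists_desc {B P M C : Type*} [Ring B] [AddCommGroup P] [Module B P] [AddCommGroup M]
    [Module B M] [AddCommGroup C] [Module B C] {π : P →ₗ[B] M} (hπ : Function.Surjective π)
    (ψ : P →ₗ[B] C) (hψ : ∀ x, π x = 0 → ψ x = 0) : ∃ h : M →ₗ[B] C, h ∘ₗ π = ψ := by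
  refine ⟨(LinearMap.ker π).liftQ ψ hψ ∘ₗ (π.quotKerEquivOfSurjective hπ).symm.toLinearMap, ?_⟩
  ext x
  have : (π.quotKerEquivOfSurjective hπ).symm (π x) = (LinearMap.ker π).mkQ x := by
    rw [LinearEquiv.symm_apply_eq]
    rfl
  rw [LinearMap.comp_apply, LinearMap.comp_apply, LinearEquiv.coe_coe, this]
  exact Submodule.liftQ_apply _ _ _

/-- A right `A`-module `Y` is reflexive if every left linear functional on `Y^*` is the evaluation
at a unique element of `Y`. -/
def IsRightReflexive (A : Type u) [Ring A] (Y : Type u) [AddCommGroup Y] [Module Aᵐᵒᵖ Y] : Prop :=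
  (∀ y : Y, (∀ φ : Y →ₗ[Aᵐᵒᵖ] A, φ y = 0) → y = 0) ∧
    ∀ F : (Y →ₗ[Aᵐᵒᵖ] A) →ₗ[A] A, ∃ y : Y, ∀ φ, F φ = φ y

/-- The evaluation at an element of a right module. -/
def evalRight {Y : Type u} [AddCommGroup Y] [Module Aᵐᵒᵖ Y] (y : Y) :
    (Y →ₗ[Aᵐᵒᵖ] A) →ₗ[A] A where
  toFun φ := φ y
  map_add' _ _ := rfl
  map_smul' _ _ := rfl

section Projective

variable (P : Type u) [AddCommGroup P] [Module Aᵐᵒᵖ P] [Module.Finite Aᵐᵒᵖ P]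
  [Module.Projective Aᵐᵒᵖ P]

/-- A dual basis of a finitely generated projective right module. -/
lemma exists_dual_basis : ∃ (n : ℕ) (b : Fin n → P) (β : Fin n → P →ₗ[Aᵐᵒᵖ] A),
    (∀ p, ∑ i, op (β i p) • b i = p) ∧ ∀ φ : P →ₗ[Aᵐᵒᵖ] A, ∑ i, φ (b i) • β i = φ := by
  obtain ⟨n, f, hf⟩ := Module.Finite.exists_fin' Aᵐᵒᵖ P
  obtain ⟨s, hs⟩ := Module.projective_lifting_property f LinearMap.id hf
  let o : Aᵐᵒᵖ →ₗ[Aᵐᵒᵖ] A := { toFun := unop, map_add' := fun _ _ => rfl, map_smul' := fun _ _ => rfl }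
  have h1 : ∀ p, ∑ i, op (o (s p i)) • f (Pi.single i 1) = p := by
    intro p
    have h2 : f (∑ i, Pi.single i (s p i)) = p := by
      rw [Finset.univ_sum_single]
      exact LinearMap.congr_fun hs p
    rw [map_sum] at h2
    rw [← h2]
    refine Finset.sum_congr rfl fun i _ => ?_
    rw [h2, ← map_smul, ← Pi.single_smul]
    simp [o]
  refine ⟨n, fun i => f (Pi.single i 1), fun i => o ∘ₗ LinearMap.proj i ∘ₗ s, h1, fun φ => ?_⟩
  ext p
  conv_rhs => rw [← h1 p, map_sum]
  rw [LinearMap.sum_apply]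
  refine Finset.sum_congr rfl fun i _ => ?_
  rw [map_smul]
  rfl

lemma isRightReflexive_of_projective : IsRightReflexive A P := by
  obtain ⟨n, b, β, h1, h2⟩ := exists_dual_basis (A := A) P
  constructor
  · intro y hy
    rw [← h1 y]
    simp [hy]
  · intro F
    refine ⟨∑ i, op (F (β i)) • b i, fun φ => ?_⟩
    conv_lhs => rw [← h2 φ, map_sum]
    rw [map_sum]
    refine Finset.sum_congr rfl fun i _ => ?_
    rw [map_smul, map_smul]
    rfl

lemma projective_dual : Module.Projective A (P →ₗ[Aᵐᵒᵖ] A) := by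
  obtain ⟨n, b, β, h1, h2⟩ := exists_dual_basis (A := A) P
  let i : (P →ₗ[Aᵐᵒᵖ] A) →ₗ[A] (Fin n → A) :=
    { toFun := fun φ i => φ (b i), map_add' := fun _ _ => rfl, map_smul' := fun _ _ => rfl }
  refine Module.Projective.of_split i (Fintype.linearCombination A β) ?_
  ext1 φ
  rw [LinearMap.comp_apply, Fintype.linearCombination_apply]
  exact h2 φ

end Projective

variable (R : Type u) [CommRing R] [IsNoetherianRing R] [Algebra R A] [Module.Finite R A]

lemma StablyIso.dual {M N : FGModuleCat.{u} Aᵐᵒᵖ} (h : StablyIso M N) :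
    StablyIso (dual R M) (dual R N) := by
  have key : ∀ {K : FGModuleCat.{u} Aᵐᵒᵖ} (f : K →ₗ[Aᵐᵒᵖ] K),
      FactorsThroughProjective Aᵐᵒᵖ (f - LinearMap.id) →
      FactorsThroughProjective A (dualMap R f - LinearMap.id) := by
    rintro K f ⟨Q, hQ, a, b, hab⟩
    refine ⟨CMOrder.dual R Q, projective_dual Q, dualMap R b, dualMap R a, ?_⟩
    ext φ
    refine LinearMap.ext fun x => ?_
    obtain ⟨ψ, rfl⟩ : ∃ ψ : K →ₗ[Aᵐᵒᵖ] A, ψ = φ := ⟨φ, rfl⟩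
    have h1 := congrArg ψ (LinearMap.congr_fun hab x)
    rw [LinearMap.sub_apply, map_sub] at h1
    exact h1
  obtain ⟨f, g, h1, h2⟩ := h
  -- `f^* g^* = (g f)^*`
  exact ⟨dualMap R g, dualMap R f, key _ h1, key _ h2⟩

lemma exact_dualMap {K P M : FGModuleCat.{u} Aᵐᵒᵖ} {i : K →ₗ[Aᵐᵒᵖ] P} {p : P →ₗ[Aᵐᵒᵖ] M}
    (hex : Function.Exact i p) (hp : Function.Surjective p) :
    Function.Exact (dualMap R p) (dualMap R i) := by
  intro ψ
  constructor
  · intro hψ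
    obtain ⟨h, hh⟩ := exists_desc hp (show P →ₗ[Aᵐᵒᵖ] A from ψ) fun x hx => by
      obtain ⟨k, rfl⟩ := (hex x).1 hx
      exact LinearMap.congr_fun hψ k
    exact ⟨h, hh⟩
  · rintro ⟨h, rfl⟩
    refine LinearMap.ext fun k => ?_
    change (show M →ₗ[Aᵐᵒᵖ] A from h) (p (i k)) = 0
    rw [(hex _).2 ⟨k, rfl⟩, map_zero]

lemma dualMap_injective {P M : FGModuleCat.{u} Aᵐᵒᵖ} {p : P →ₗ[Aᵐᵒᵖ] M}
    (hp : Function.Surjective p) : Function.Injective (dualMap R p) := by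
  intro φ ψ h
  refine LinearMap.ext fun x => ?_
  obtain ⟨y, rfl⟩ := hp x
  exact LinearMap.congr_fun h y

variable {R}

/-- If `Ext^1(M, A) = 0`, dualising `0 → Ω M → P → M → 0` exhibits `M^*` as a syzygy
of `(Ω M)^*`. -/
lemma SyzygyMapsExtend.stablyIso_dual {M : FGModuleCat.{u} Aᵐᵒᵖ} (hM : SyzygyMapsExtend R A M) :
    StablyIso (dual R M) (syz R (dual R (syz R M))) := by
  have := (cover M).projective
  have h1 : Module.Projective A (dual R (cover M).P) := projective_dual _
  have := (cover (dual R (syz R M))).projective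
  obtain ⟨u, v, h1, h2, -⟩ := exists_stable_inverse (dualMap_injective R (cover M).surjective)
    (exact_dualMap R (syz_exact R M) (cover M).surjective) (fun h => hM h)
    (syzIncl_injective (R := R)) (syz_exact R _) (cover (dual R (syz R M))).surjective
  exact ⟨u, v, h1, h2⟩

/-- If moreover `M` is reflexive, then `Ext^1((Ω M)^*, A) = 0`. -/
lemma SyzygyMapsExtend.dual_syz {M : FGModuleCat.{u} Aᵐᵒᵖ} (hM : SyzygyMapsExtend R A M)
    (hr : IsRightReflexive A M) : SyzygyMapsExtend R A (dual R (syz R M)) := by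
  have := (cover M).projective
  have h1 : Module.Projective A (dual R (cover M).P) := projective_dual _
  rw [← subsingleton_ext_one_iff, subsingleton_ext_one_iff_of_exact A
    (dualMap_injective R (cover M).surjective)
    (exact_dualMap R (syz_exact R M) (cover M).surjective) (fun h => hM h)]
  intro F
  obtain ⟨m, hm⟩ := hr.2 F
  obtain ⟨p, rfl⟩ := (cover M).surjective m
  refine ⟨evalRight p, ?_⟩
  ext φ
  exact (hm φ).symm

/-- Second syzygies with vanishing `Ext^1` in between are reflexive. -/
lemma SyzygyMapsExtend.isRightReflexive {W : FGModuleCat.{u} Aᵐᵒᵖ}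
    (hW : SyzygyMapsExtend R A (syz R W)) : IsRightReflexive A (syz R (syz R W)) := by
  have := (cover W).projective
  have := (cover (syz R W)).projective
  have h0 := isRightReflexive_of_projective (A := A) (cover W).P
  have h1 := isRightReflexive_of_projective (A := A) (cover (syz R W)).P
  constructor
  · intro y hy
    apply syzIncl_injective
    rw [map_zero]
    exact h1.1 _ fun φ => hy (φ ∘ₗ syzIncl R _)
  · intro F
    obtain ⟨p, hp⟩ := h1.2 (F ∘ₗ dualMap R (syzIncl R (syz R W)))
    have hp0 : (cover (syz R W)).π p = 0 := by
      apply syzIncl_injective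
      rw [map_zero]
      refine h0.1 _ fun φ => ?_
      have : dualMap R (syzIncl R (syz R W)) ((φ ∘ₗ syzIncl R W) ∘ₗ (cover (syz R W)).π) = 0 := by
        refine LinearMap.ext fun x => ?_
        change φ (syzIncl R W ((cover (syz R W)).π (syzIncl R _ x))) = 0
        rw [cover_π_syzIncl, map_zero, map_zero]
      exact (hp ((φ ∘ₗ syzIncl R W) ∘ₗ (cover (syz R W)).π)).symm.trans
        ((congrArg F this).trans (map_zero F))
    obtain ⟨y, rfl⟩ := (syz_exact R _ p).1 hp0
    refine ⟨y, fun φ => ?_⟩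
    obtain ⟨g, rfl⟩ := hW φ
    exact hp g

/-- The dual of a reflexive module is reflexive. -/
lemma IsRightReflexive.isReflexive {Y : FGModuleCat.{u} Aᵐᵒᵖ} (hY : IsRightReflexive A Y)
    {Z : FGModuleCat.{u} A} (e : Z ≃ₗ[A] dual R Y) : IsReflexive A Z := by
  constructor
  · rw [injective_iff_map_eq_zero]
    intro z hz
    apply e.injective
    rw [map_zero]
    refine LinearMap.ext fun y => ?_
    exact LinearMap.congr_fun hz (evalRight y ∘ₗ e.toLinearMap)
  · intro G
    let φ : Y →ₗ[Aᵐᵒᵖ] A :=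
      { toFun := fun y => G (evalRight y ∘ₗ e.toLinearMap)
        map_add' := fun x y => by
          rw [← map_add]
          congr 1
          ext z
          exact map_add (show Y →ₗ[Aᵐᵒᵖ] A from e z) x y
        map_smul' := fun a y => by
          rw [RingHom.id_apply, ← map_smul]
          congr 1
          ext z
          exact map_smul (show Y →ₗ[Aᵐᵒᵖ] A from e z) a y }
    refine ⟨e.symm φ, ?_⟩
    ext ζ
    obtain ⟨y, hy⟩ := hY.2 (ζ ∘ₗ e.symm.toLinearMap)
    have h1 : ζ = evalRight y ∘ₗ e.toLinearMap := by
      ext z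
      have h2 := hy (e z)
      change ζ (e.symm (e z)) = _ at h2
      rw [e.symm_apply_apply] at h2
      exact h2
    change ζ (e.symm φ) = G ζ
    have h2 : ζ (e.symm φ) = φ y := hy φ
    rw [h2]
    conv_rhs => rw [h1]
    rfl

/-- An idempotent endomorphism of `Y^*` factoring through a projective vanishes if `Y` is reflexive
without projective summands: it is the dual of an endomorphism of `Y` of the same kind. -/
lemma HasNoProjectiveSummand.eq_zero_of_dual {Y : FGModuleCat.{u} Aᵐᵒᵖ}
    (hY : HasNoProjectiveSummand Y) (hr : IsRightReflexive A Y)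
    (e : (Y →ₗ[Aᵐᵒᵖ] A) →ₗ[A] (Y →ₗ[Aᵐᵒᵖ] A)) (he : e ∘ₗ e = e) {Q : Type u} [AddCommGroup Q]
    [Module A Q] [Module.Finite A Q] [Module.Projective A Q] (a : (Y →ₗ[Aᵐᵒᵖ] A) →ₗ[A] Q)
    (b : Q →ₗ[A] (Y →ₗ[Aᵐᵒᵖ] A)) (hab : e = b ∘ₗ a) : e = 0 := by
  obtain ⟨n, f, hf⟩ := Module.Finite.exists_fin' A Q
  obtain ⟨s, hs⟩ := Module.projective_lifting_property f LinearMap.id hf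
  choose y hy using fun i : Fin n => hr.2 (LinearMap.proj i ∘ₗ s ∘ₗ a)
  let β : Fin n → Y →ₗ[Aᵐᵒᵖ] A := fun i => b (f (Pi.single i 1))
  have heφ : ∀ φ : Y →ₗ[Aᵐᵒᵖ] A, e φ = ∑ i, φ (y i) • β i := by
    intro φ
    have h1 : f (∑ i, Pi.single i (s (a φ) i)) = a φ := by
      rw [Finset.univ_sum_single]
      exact LinearMap.congr_fun hs (a φ)
    have h2 : e φ = b (f (∑ i, Pi.single i (s (a φ) i))) := by
      rw [h1]
      exact LinearMap.congr_fun hab φ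
    rw [h2, map_sum, map_sum]
    refine Finset.sum_congr rfl fun i _ => ?_
    rw [← hy i φ]
    change _ = s (a φ) i • b (f (Pi.single i 1))
    rw [← map_smul, ← map_smul, ← Pi.single_smul, smul_eq_mul, mul_one]
  let t : Y →ₗ[Aᵐᵒᵖ] (Fin n → Aᵐᵒᵖ) := LinearMap.pi fun i =>
    { toFun := fun x => op (β i x)
      map_add' := fun x x' => by rw [map_add, MulOpposite.op_add]
      map_smul' := fun r x => by rw [map_smul]; rfl }
  let e' : Y →ₗ[Aᵐᵒᵖ] Y := Fintype.linearCombination Aᵐᵒᵖ y ∘ₗ t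
  have he' : ∀ (φ : Y →ₗ[Aᵐᵒᵖ] A) x, φ (e' x) = e φ x := by
    intro φ x
    rw [heφ, LinearMap.comp_apply, Fintype.linearCombination_apply, map_sum, LinearMap.sum_apply]
    refine Finset.sum_congr rfl fun i _ => ?_
    rw [map_smul]
    rfl
  have h0 : e' = 0 := by
    refine hY e' ?_ ⟨FGModuleCat.of Aᵐᵒᵖ (Fin n → Aᵐᵒᵖ),
      inferInstanceAs (Module.Projective Aᵐᵒᵖ (Fin n → Aᵐᵒᵖ)), t, Fintype.linearCombination Aᵐᵒᵖ y,
      rfl⟩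
    ext x
    rw [← sub_eq_zero]
    refine hr.1 _ fun φ => ?_
    rw [map_sub, LinearMap.comp_apply, he', he', sub_eq_zero, he']
    exact congrArg (fun ψ : Y →ₗ[Aᵐᵒᵖ] A => ψ x) (LinearMap.congr_fun he φ)
  ext φ x
  have := he' φ x
  rw [h0, LinearMap.zero_apply, map_zero] at this
  exact this.symm

/-- Dualising preserves the absence of projective summands of reflexive modules. -/
lemma HasNoProjectiveSummand.dual {Y : FGModuleCat.{u} Aᵐᵒᵖ} (hY : HasNoProjectiveSummand Y)
    (hr : IsRightReflexive A Y) : HasNoProjectiveSummand (dual R Y) := by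
  rintro e he ⟨Q, hQ, a, b, hab⟩
  exact hY.eq_zero_of_dual hr e he a b hab

end Dual

/-! ### The transpose and the dual of the second syzygy -/

section Transpose

variable {R : Type u} [CommRing R] [IsNoetherianRing R]
  {A : Type u} [Ring A] [Algebra R A] [Module.Finite R A]

variable (R) in
/-- The map `Tr M → (Ω² M)^*` given by restricting functionals on `P₁` to `Ω² M`. -/
def transposeToDual (M : FGModuleCat.{u} Aᵐᵒᵖ) : transpose R M →ₗ[A] dual R (syz R (syz R M)) :=
  (LinearMap.range (dualMap R (presMap R M))).liftQ (dualMap R (syzIncl R (syz R M))) (by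
    rintro _ ⟨φ, rfl⟩
    refine LinearMap.ext fun x => ?_
    obtain ⟨ψ, rfl⟩ : ∃ ψ : (cover M).P →ₗ[Aᵐᵒᵖ] A, ψ = φ := ⟨φ, rfl⟩
    change ψ (syzIncl R M ((cover (syz R M)).π (syzIncl R (syz R M) x))) = 0
    rw [cover_π_syzIncl, map_zero, map_zero])

variable {M : FGModuleCat.{u} Aᵐᵒᵖ}

lemma transposeToDual_injective_iff :
    Function.Injective (transposeToDual R M) ↔ SyzygyMapsExtend R A M := by
  constructor
  · intro hinj h
    let ψ : dual R (cover (syz R M)).P := h ∘ₗ (cover (syz R M)).π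
    have h1 : (LinearMap.range (dualMap R (presMap R M))).mkQ ψ = 0 := by
      refine hinj (Eq.trans ?_ (map_zero (transposeToDual R M)).symm)
      refine LinearMap.ext fun x => ?_
      change h ((cover (syz R M)).π (syzIncl R (syz R M) x)) = 0
      rw [cover_π_syzIncl, map_zero]
    obtain ⟨g, hg⟩ := (Submodule.Quotient.mk_eq_zero _).1 h1
    refine ⟨g, LinearMap.ext fun x => ?_⟩
    obtain ⟨y, rfl⟩ := (cover (syz R M)).surjective x
    exact LinearMap.congr_fun hg y
  · intro hM
    refine (injective_iff_map_eq_zero (transposeToDual R M)).2 fun z hz => ?_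
    obtain ⟨ψ, rfl⟩ := Submodule.mkQ_surjective _ z
    obtain ⟨h, hh⟩ := exists_desc (cover (syz R M)).surjective
      (show (cover (syz R M)).P →ₗ[Aᵐᵒᵖ] A from ψ) fun x hx => by
        obtain ⟨y, rfl⟩ := (syz_exact R _ x).1 hx
        exact LinearMap.congr_fun hz y
    obtain ⟨g, rfl⟩ := hM h
    exact (Submodule.Quotient.mk_eq_zero _).2 ⟨g, hh⟩

lemma transposeToDual_surjective_iff :
    Function.Surjective (transposeToDual R M) ↔ SyzygyMapsExtend R A (syz R M) := by
  constructor
  · intro hsurj h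
    obtain ⟨z, hz⟩ := hsurj h
    obtain ⟨ψ, rfl⟩ := Submodule.mkQ_surjective _ z
    exact ⟨ψ, hz⟩
  · intro hM h
    obtain ⟨g, hg⟩ := hM h
    exact ⟨(LinearMap.range (dualMap R (presMap R M))).mkQ g, hg⟩

variable (R) in
/-- The map `D_d U → D_d Z` induced by `f : Z → U`. -/
def baseDualMap {Z U : FGModuleCat.{u} A} (f : Z →ₗ[A] U) :
    BaseDual R U.obj →ₗ[Aᵐᵒᵖ] BaseDual R Z.obj :=
  let F : RestrictScalars R A Z →ₗ[R] RestrictScalars R A U :=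
    { toFun := f
      map_add' := map_add f
      map_smul' := fun r z => by
        obtain ⟨z, rfl⟩ : ∃ y : Z, y = z := ⟨z, rfl⟩
        exact map_smul f (algebraMap R A r) z }
  { toFun := fun φ => LinearMap.comp φ F
    map_add' := fun _ _ => rfl
    map_smul' := fun a φ => LinearMap.ext fun z => by
      obtain ⟨z, rfl⟩ : ∃ y : Z, y = z := ⟨z, rfl⟩
      exact congrArg (show RestrictScalars R A U →ₗ[R] R from φ) (map_smul f (unop a) z).symm }

omit [IsNoetherianRing R] [Module.Finite R A] in
/-- Isomorphic left modules have isomorphic base duals. -/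
lemma nonempty_Dd_iso {Z U : FGModuleCat.{u} A} (e : Z ≃ₗ[A] U) : Nonempty (Dd R Z ≅ Dd R U) := by
  refine ⟨LinearEquiv.toModuleIso (X₁ := BaseDual R Z.obj) (X₂ := BaseDual R U.obj)
    (LinearEquiv.ofLinearMap (baseDualMap R e.symm.toLinearMap) (baseDualMap R e.toLinearMap)
    (LinearMap.ext fun φ => LinearMap.ext fun z => ?_)
    (LinearMap.ext fun φ => LinearMap.ext fun z => ?_))⟩
  · exact congrArg (show RestrictScalars R A U →ₗ[R] R from φ) (e.apply_symm_apply z)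
  · exact congrArg (show RestrictScalars R A Z →ₗ[R] R from φ) (e.symm_apply_apply z)

end Transpose

/-! ### Positive dimension -/

/-- The regular right module, as a module on `Aᵐᵒᵖ` and as a module on `A`. -/
def opLinearEquivSelf (A : Type u) [Ring A] : A ≃ₗ[Aᵐᵒᵖ] Aᵐᵒᵖ where
  toFun := op
  map_add' _ _ := rfl
  map_smul' _ _ := rfl
  invFun := unop
  left_inv _ := rfl
  right_inv _ := rfl

section Positive

variable {R : Type u} [CommRing R] [IsNoetherianRing R] {A : Type u} [Ring A] [Algebra R A]
  [Module.Finite R A] {X : FGModuleCat.{u} Aᵐᵒᵖ}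

/-- Taking syzygies of `(Ω^{k+n} X)^*` undoes syzygies of `X`. -/
lemma stablyIso_syzPow_dual (hext : ∀ n, SyzygyMapsExtend R A (syzPow R n X)) (n k : ℕ) :
    StablyIso (syzPow R n (dual R (syzPow R (k + n) X))) (dual R (syzPow R k X)) := by
  induction n with
  | zero => exact .refl _
  | succ n ih =>
    rw [← add_assoc, syzPow_succ' (k + n)]
    exact ((hext (k + n)).stablyIso_dual.symm.syzPow n).trans ih

/-- If all `Ext^i(X, A)` vanish and `X` is stably isomorphic to `Ω^l X`, then the syzygies of `Tr X`
are the duals of syzygies of `X`. -/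
lemma stablyIso_syzPow_transpose (hext : ∀ n, SyzygyMapsExtend R A (syzPow R n X)) {l : ℕ}
    (hl : StablyIso (syzPow R l X) X) {n k : ℕ} (hn : k + n = l + 2) :
    StablyIso (syzPow R n (transpose R X)) (dual R (syzPow R k X)) := by
  let e : transpose R X ≃ₗ[A] dual R (syzPow R 2 X) := LinearEquiv.ofBijective
    (transposeToDual R X) ⟨transposeToDual_injective_iff.2 (hext 0),
      transposeToDual_surjective_iff.2 (hext 1)⟩
  have h1 : StablyIso (syzPow R (k + n) X) (syzPow R 2 X) := by
    have h2 : syzPow R (k + n) X = syzPow R 2 (syzPow R l X) := by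
      rw [hn, add_comm]
      exact Function.iterate_add_apply _ _ _ _
    rw [h2]
    exact hl.syzPow 2
  exact (((StablyIso.of_equiv e).trans (h1.dual R).symm).syzPow n).trans
    (stablyIso_syzPow_dual hext n k)

/-- In positive dimension, `Tr_d X` is the dual of the reflexive module `Ω^{d+2} X`: they
are stably isomorphic, and neither has projective summands. -/
lemma nonempty_Trd_equiv [IsLocalRing R] [IsAdicComplete (IsLocalRing.maximalIdeal R) R]
    (hext : ∀ n, SyzygyMapsExtend R Aᵐᵒᵖ (syzPow R n X)) {d : ℕ} (hd : 0 < d)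
    (hl : StablyIso (syzPow R (2 * d) X) X) :
    IsRightReflexive A (syzPow R (d + 2) X) ∧
      Nonempty (Trd R d X ≃ₗ[A] dual R (syzPow R (d + 2) X)) := by
  obtain ⟨d, rfl⟩ : ∃ c, d = c + 1 := ⟨d - 1, by omega⟩
  have hext' : ∀ n, SyzygyMapsExtend R A (syzPow R n X) := fun n =>
    (hext n).congr (opLinearEquivSelf A).symm
  have hrefl : IsRightReflexive A (syzPow R (d + 1 + 2) X) := by
    have := hext' (d + 1 + 1)
    rw [syzPow_succ'] at this
    rw [syzPow_succ', syzPow_succ']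
    exact this.isRightReflexive
  refine ⟨hrefl, ?_⟩
  have h1 : StablyIso (Trd R (d + 1) X) (dual R (syzPow R (d + 1 + 2) X)) :=
    stablyIso_syzPow_transpose hext' hl (by ring)
  refine h1.nonempty_equiv R ?_ ?_
  · have h2 : SyzygyMapsExtend R A (syzPow R d (transpose R X)) := by
      refine .of_stablyIso (stablyIso_syzPow_transpose (k := d + 1 + 2 + 1) hext' hl (by ring)) ?_
      rw [syzPow_succ' (d + 1 + 2)]
      exact (hext' (d + 1 + 2)).dual_syz hrefl
    have h3 := h2.hasNoProjectiveSummand (cover_isCover_of_complete R _)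
    rwa [← syzPow_succ'] at h3
  · refine HasNoProjectiveSummand.dual ?_ hrefl
    rw [syzPow_succ' (d + 1 + 1)]
    exact (hext (d + 1 + 1)).hasNoProjectiveSummand (cover_isCover_of_complete R _)

end Positive

/-! ### Gorenstein rings of dimension zero are self-injective -/

section SelfInjective

variable {R : Type u} [CommRing R] [IsLocalRing R] [IsNoetherianRing R]

/-- A zero-dimensional noetherian local ring contains a copy of its residue field. -/
lemma exists_mul_eq_zero_iff_mem_maximalIdeal (hd : ringKrullDim R = 0) :
    ∃ s : R, ∀ r, r * s = 0 ↔ r ∈ IsLocalRing.maximalIdeal R := by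
  have := ringKrullDimZero_iff_ringKrullDim_eq_zero.2 hd
  obtain ⟨p, hp⟩ := associatedPrimes.nonempty R R
  obtain ⟨hp, s, hs⟩ := (isAssociatedPrime_iff (M := R)).1 hp
  have hm : p = IsLocalRing.maximalIdeal R :=
    IsLocalRing.eq_maximalIdeal hp.isMaximal'
  refine ⟨s, fun r => ?_⟩
  rw [← hm, hs, Submodule.mem_colon_singleton, Submodule.mem_bot, smul_eq_mul]

/-- In dimension zero, `Ext^{n+1}(-, R) = 0` implies `Ext^n(-, R) = 0` for `n > 0`: as the residue
field embeds in `R`, this holds at the residue field, of which every finitely generated module is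
an iterated extension. -/
lemma subsingleton_ext_of_succ (hd : ringKrullDim R = 0) (n : ℕ)
    (h : ∀ (Y : Type u) [AddCommGroup Y] [Module R Y], Module.Finite R Y →
      Subsingleton (Abelian.Ext (ModuleCat.of R Y) (ModuleCat.of R R) (n + 1 + 1)))
    (Y : Type u) [AddCommGroup Y] [Module R Y] (hY : Module.Finite R Y) :
    Subsingleton (Abelian.Ext (ModuleCat.of R Y) (ModuleCat.of R R) (n + 1)) := by
  have := ringKrullDimZero_iff_ringKrullDim_eq_zero.2 hd
  obtain ⟨s, hs⟩ := exists_mul_eq_zero_iff_mem_maximalIdeal hd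
  induction hY using IsNoetherianRing.induction_on_isQuotientEquivQuotientPrime with
  | subsingleton N =>
    refine subsingleton_of_forall_eq 0 fun x => ?_
    rw [← x.mk₀_id_comp, (ModuleCat.isZero_of_subsingleton (ModuleCat.of R N)).eq_of_src (𝟙 _) 0]
    simp
  | quotient N p e =>
    have hm : p.1 = IsLocalRing.maximalIdeal R :=
      IsLocalRing.eq_maximalIdeal p.2.isMaximal'
    let i : (R ⧸ p.1) →ₗ[R] R := Submodule.liftQ p.1 (LinearMap.toSpanSingleton R R s)
      fun r hr => (hs r).2 (hm ▸ hr)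
    have hi : Function.Injective i := by
      refine (injective_iff_map_eq_zero i).2 fun x hx => ?_
      obtain ⟨r, rfl⟩ := Submodule.mkQ_surjective _ x
      refine (Submodule.Quotient.mk_eq_zero _).2 ?_
      rw [hm]
      exact (hs r).1 hx
    have hS := shortExact_of_exact (i := i ∘ₗ e.toLinearMap) (hi.comp e.injective)
      (LinearMap.exact_map_mkQ_range _) (Submodule.mkQ_surjective _)
    have hP : Projective (ModuleCat.of R R) := ModuleCat.projective_of_categoryTheory_projective _
    refine subsingleton_of_forall_eq 0 fun x => ?_
    obtain ⟨y, rfl⟩ := Abelian.Ext.contravariant_sequence_exact₁ hS _ x (add_comm _ _)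
      (Subsingleton.elim (h := h _ inferInstance) _ _)
    rw [Abelian.Ext.eq_zero_of_projective (P := ModuleCat.of R R) y]
    simp
  | exact N₁ N₂ N₃ f g hf hg hfg h₁ h₃ =>
    have hS := shortExact_of_exact hf hfg hg
    refine subsingleton_of_forall_eq 0 fun x => ?_
    obtain ⟨y, rfl⟩ := Abelian.Ext.contravariant_sequence_exact₂ hS _ x
      (Subsingleton.elim (h := h₁) _ _)
    rw [Subsingleton.elim (h := h₃) y 0]
    simp

/-- A zero-dimensional Gorenstein local ring is self-injective: the vanishing
of `Ext^{n+1}(-, R)` on finitely generated modules descends to `Ext^1`, which gives Baer's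
criterion. -/
lemma injective_of_isGorensteinLocal (hR : IsGorensteinLocal R) (hd : ringKrullDim R = 0) :
    Module.Injective R R := by
  obtain ⟨n, hn⟩ := (injectiveDimension_ne_top_iff _).1 hR
  have h1 : ∀ (Y : Type u) [AddCommGroup Y] [Module R Y], Module.Finite R Y →
      Subsingleton (Abelian.Ext (ModuleCat.of R Y) (ModuleCat.of R R) (n + 1)) :=
    fun Y _ _ _ => HasInjectiveDimensionLT.subsingleton _ (n + 1) _ le_rfl _
  clear hn
  induction n with
  | zero =>
    refine Module.Baer.injective fun I g => ?_
    obtain ⟨g', hg'⟩ := (subsingleton_ext_one_iff_of_exact R (i := I.subtype)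
      I.injective_subtype (LinearMap.exact_subtype_mkQ I) I.mkQ_surjective).1
      (h1 (R ⧸ I) inferInstance) g
    exact ⟨g', fun x hx => LinearMap.congr_fun hg' ⟨x, hx⟩⟩
  | succ n ih => exact ih fun Y _ _ hY => subsingleton_ext_of_succ hd n h1 Y hY

end SelfInjective

/-! ### Duality over a zero-dimensional Gorenstein ring -/

section Matlis

variable {R : Type u} [CommRing R] [IsLocalRing R] [IsNoetherianRing R]

/-- Linear functionals separate points. -/
lemma exists_functional_ne_zero (hR : IsGorensteinLocal R) (hd : ringKrullDim R = 0) {V : Type u}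
    [AddCommGroup V] [Module R V] {v : V} (hv : v ≠ 0) : ∃ f : V →ₗ[R] R, f v ≠ 0 := by
  have := injective_of_isGorensteinLocal hR hd
  obtain ⟨s, hs⟩ := exists_mul_eq_zero_iff_mem_maximalIdeal hd
  -- `v ↦ s` is well defined on `R v`, as `s` is killed by all non-units
  obtain ⟨h, hh⟩ := exists_desc (LinearMap.toSpanSingleton R V v).surjective_rangeRestrict
    (LinearMap.toSpanSingleton R R s) fun r hr => by
      have hr' : r • v = 0 := congrArg Subtype.val hr
      refine (hs r).2 fun hu => hv ?_
      rw [← one_smul R v, ← hu.val_inv_mul, mul_smul, hr', smul_zero]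
  obtain ⟨f, hf⟩ := Module.Injective.out (LinearMap.range (LinearMap.toSpanSingleton R V v)).subtype
    (Submodule.injective_subtype _) h
  refine ⟨f, ?_⟩
  have h1 := hf ((LinearMap.toSpanSingleton R V v).rangeRestrict 1)
  have h2 := LinearMap.congr_fun hh 1
  simp only [LinearMap.comp_apply, LinearMap.toSpanSingleton_apply, one_smul] at h2
  rw [h2] at h1
  have h3 : f v = s := by simpa using h1
  rw [h3]
  rintro rfl
  exact (IsLocalRing.maximalIdeal.isMaximal R).ne_top
    ((Ideal.eq_top_iff_one _).2 ((hs 1).1 (mul_zero 1)))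

/-- Finitely generated modules are reflexive. -/
lemma exists_eq_eval (hR : IsGorensteinLocal R) (hd : ringKrullDim R = 0) {V : Type u}
    [AddCommGroup V] [Module R V] [Module.Finite R V] (F : (V →ₗ[R] R) →ₗ[R] R) :
    ∃ v : V, ∀ f, F f = f v := by
  have := injective_of_isGorensteinLocal hR hd
  obtain ⟨n, p, hp⟩ := Module.Finite.exists_fin' R V
  obtain ⟨G, hG⟩ := Module.Injective.out (p.lcomp R R) (fun f g hfg => by
    refine LinearMap.ext fun x => ?_
    obtain ⟨y, rfl⟩ := hp x
    exact LinearMap.congr_fun hfg y) F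
  refine ⟨p fun i => G (LinearMap.proj i), fun f => ?_⟩
  rw [← hG f]
  have h1 : p.lcomp R R f = ∑ i, f (p (Pi.single i 1)) • LinearMap.proj i := by
    refine (Pi.basisFun R (Fin n)).ext fun i => ?_
    simp [Pi.single_apply]
  have h2 : (fun i => G (LinearMap.proj i)) = ∑ i, G (LinearMap.proj i) • Pi.single i (1 : R) := by
    ext j
    simp [Pi.single_apply]
  rw [h1, h2, map_sum, map_sum, map_sum]
  refine Finset.sum_congr rfl fun i _ => ?_
  rw [map_smul, map_smul, map_smul, smul_eq_mul, smul_eq_mul, mul_comm]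

variable {A : Type u} [Ring A] [Algebra R A] [Module.Finite R A]

omit [Module.Finite R A] in
lemma exists_baseDual_ne_zero (hR : IsGorensteinLocal R) (hd : ringKrullDim R = 0)
    {Z : FGModuleCat.{u} A} {z : Z} (hz : z ≠ 0) : ∃ f : RestrictScalars R A Z →ₗ[R] R, f z ≠ 0 :=
  letI : Module R Z := Module.compHom Z (algebraMap R A)
  exists_functional_ne_zero (V := Z) hR hd hz

lemma exists_eq_eval_baseDual (hR : IsGorensteinLocal R) (hd : ringKrullDim R = 0)
    {Z : FGModuleCat.{u} A} (F : (RestrictScalars R A Z →ₗ[R] R) →ₗ[R] R) :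
    ∃ z : Z, ∀ f, F f = f z :=
  letI : Module R Z := Module.compHom Z (algebraMap R A)
  have : IsScalarTower R A Z := .of_algebraMap_smul fun _ _ => rfl
  have : Module.Finite R Z := Module.Finite.trans A Z
  exists_eq_eval (V := Z) hR hd F

/-- `D_d` is full. -/
lemma exists_eq_baseDualMap (hR : IsGorensteinLocal R) (hd : ringKrullDim R = 0)
    {Z U : FGModuleCat.{u} A} (e : BaseDual R Z.obj →ₗ[Aᵐᵒᵖ] BaseDual R U.obj) :
    ∃ Φ : U →ₗ[A] Z, baseDualMap R Φ = e := by
  have he : ∀ (r : R) (f : RestrictScalars R A Z →ₗ[R] R),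
      (show RestrictScalars R A U →ₗ[R] R from e (r • f : RestrictScalars R A Z →ₗ[R] R)) =
        r • (show RestrictScalars R A U →ₗ[R] R from e f) := by
    have key : ∀ {V : FGModuleCat.{u} A} (r : R) (f : RestrictScalars R A V →ₗ[R] R),
        (r • f : RestrictScalars R A V →ₗ[R] R) =
          (op (algebraMap R A r) • (show BaseDual R V.obj from f) : BaseDual R V.obj) :=
      fun r f => LinearMap.ext fun z => (map_smul f r z).symm
    intro r f
    rw [key, key]
    exact map_smul e _ _
  let F : U → (RestrictScalars R A Z →ₗ[R] R) →ₗ[R] R := fun u =>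
    { toFun := fun f => (show RestrictScalars R A U →ₗ[R] R from e f) u
      map_add' := fun f g => LinearMap.congr_fun (f := (show RestrictScalars R A U →ₗ[R] R from
        e (f + g : RestrictScalars R A Z →ₗ[R] R))) (map_add e f g) u
      map_smul' := fun r f => LinearMap.congr_fun (f := (show RestrictScalars R A U →ₗ[R] R from
        e (r • f : RestrictScalars R A Z →ₗ[R] R))) (he r f) u }
  choose Φ hΦ using fun u => exists_eq_eval_baseDual hR hd (F u)
  have hsep : ∀ x y : Z, (∀ f : RestrictScalars R A Z →ₗ[R] R, f x = f y) →
      x = y := fun x y h => by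
    by_contra hxy
    obtain ⟨f, hf⟩ := exists_baseDual_ne_zero hR hd (sub_ne_zero.2 hxy)
    exact hf ((map_sub f x y).trans (sub_eq_zero.2 (h f)))
  refine ⟨{ toFun := Φ, map_add' := fun u v => ?_, map_smul' := fun a u => ?_ }, ?_⟩
  · refine hsep _ _ fun f => ?_
    rw [← hΦ]
    refine Eq.trans ?_ ((map_add f (Φ u) (Φ v)).trans
      (congrArg₂ (· + ·) (hΦ u f).symm (hΦ v f).symm)).symm
    exact map_add (show RestrictScalars R A U →ₗ[R] R from e f) u v
  · refine hsep _ _ fun f => ?_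
    rw [← hΦ]
    refine Eq.trans ?_ (hΦ u (show RestrictScalars R A Z →ₗ[R] R from
      (op a • (show BaseDual R Z.obj from f) : BaseDual R Z.obj)))
    exact (LinearMap.congr_fun (show (show RestrictScalars R A U →ₗ[R] R from
      e (op a • (show BaseDual R Z.obj from f) : BaseDual R Z.obj)) =
      (show RestrictScalars R A U →ₗ[R] R from (op a • e f : BaseDual R U.obj))
      from map_smul e (op a) (show BaseDual R Z.obj from f)) u).symm
  · exact LinearMap.ext fun f => LinearMap.ext fun u => (hΦ u f).symm

/-- `D_d` detects isomorphisms. -/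
lemma nonempty_equiv_of_Dd_iso (hR : IsGorensteinLocal R) (hd : ringKrullDim R = 0)
    {Z U : FGModuleCat.{u} A} (h : Nonempty (Dd R Z ≅ Dd R U)) : Nonempty (Z ≃ₗ[A] U) := by
  obtain ⟨e⟩ := h
  have hf : ∀ {V : FGModuleCat.{u} A} (Φ : V →ₗ[A] V), baseDualMap R Φ = LinearMap.id →
      Φ = LinearMap.id := by
    intro V Φ hΦ
    refine LinearMap.ext fun v => ?_
    by_contra hv
    obtain ⟨f, hf⟩ := exists_baseDual_ne_zero hR hd (sub_ne_zero.2 hv)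
    refine hf ((map_sub f _ _).trans (sub_eq_zero.2 ?_))
    exact LinearMap.congr_fun (show (show RestrictScalars R A V →ₗ[R] R from baseDualMap R Φ f) = f
      from LinearMap.congr_fun hΦ f) v
  obtain ⟨Φ, hΦ⟩ := exists_eq_baseDualMap hR hd e.hom.hom
  obtain ⟨Ψ, hΨ⟩ := exists_eq_baseDualMap hR hd e.inv.hom
  refine ⟨LinearEquiv.ofLinearMap Ψ Φ (hf _ ?_) (hf _ ?_)⟩
  · have h1 : e.hom.hom ∘ₗ e.inv.hom = LinearMap.id := by
      rw [← ModuleCat.hom_comp, e.inv_hom_id]; rfl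
    rw [← hΦ, ← hΨ] at h1
    exact h1
  · have h1 : e.inv.hom ∘ₗ e.hom.hom = LinearMap.id := by
      rw [← ModuleCat.hom_comp, e.hom_inv_id]; rfl
    rw [← hΦ, ← hΨ] at h1
    exact h1

end Matlis

/-! ### Reflexivity of the transpose -/

section Reflexive

variable {R : Type u} [CommRing R] [IsNoetherianRing R] {A : Type u} [Ring A] [Algebra R A]
  [Module.Finite R A]

/-- The map `Y → Z^*` corresponding to `Z → Y^*`. -/
def flipDual {Y : FGModuleCat.{u} Aᵐᵒᵖ} {Z : FGModuleCat.{u} A} (h : Z →ₗ[A] dual R Y) :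
    Y →ₗ[Aᵐᵒᵖ] (Z →ₗ[A] A) where
  toFun y := evalRight y ∘ₗ h
  map_add' x y := LinearMap.ext fun z => map_add (show Y →ₗ[Aᵐᵒᵖ] A from h z) x y
  map_smul' a y := LinearMap.ext fun z => map_smul (show Y →ₗ[Aᵐᵒᵖ] A from h z) a y

variable (M : FGModuleCat.{u} Aᵐᵒᵖ)

/-- `Ω² M` is the dual of `Tr M`. -/
lemma bijective_flipDual_transposeToDual : Function.Bijective (flipDual (transposeToDual R M)) := by
  have := (cover M).projective
  have := (cover (syz R M)).projective
  have h0 := isRightReflexive_of_projective (A := A) (cover M).P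
  have h1 := isRightReflexive_of_projective (A := A) (cover (syz R M)).P
  constructor
  · refine (injective_iff_map_eq_zero _).2 fun x hx => ?_
    refine syzIncl_injective ((h1.1 _ fun φ => ?_).trans (map_zero _).symm)
    exact LinearMap.congr_fun hx ((LinearMap.range (dualMap R (presMap R M))).mkQ φ)
  · intro G
    obtain ⟨p, hp⟩ := h1.2 (G ∘ₗ (LinearMap.range (dualMap R (presMap R M))).mkQ)
    have hp0 : (cover (syz R M)).π p = 0 := by
      apply syzIncl_injective
      rw [map_zero]
      refine h0.1 _ fun φ => (hp (φ ∘ₗ presMap R M)).symm.trans ?_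
      exact (congrArg G ((Submodule.Quotient.mk_eq_zero _).2 ⟨φ, rfl⟩)).trans (map_zero G)
    obtain ⟨x, rfl⟩ := (syz_exact R _ p).1 hp0
    refine ⟨x, LinearMap.ext fun z => ?_⟩
    obtain ⟨ψ, rfl⟩ := Submodule.mkQ_surjective _ z
    exact (hp ψ).symm

/-- Under the identification of `Ω² M` with the dual of `Tr M`, the restriction map
`Tr M → (Ω² M)^*` is the evaluation map of `Tr M`. -/
lemma isReflexive_transpose_iff :
    IsReflexive A (transpose R M) ↔ Function.Bijective (transposeToDual R M) := by
  let κ := LinearEquiv.ofBijective _ (bijective_flipDual_transposeToDual (R := R) M)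
  let C : dual R (syz R (syz R M)) → ((transpose R M →ₗ[A] A) →ₗ[Aᵐᵒᵖ] A) := fun φ =>
    (show syz R (syz R M) →ₗ[Aᵐᵒᵖ] A from φ) ∘ₗ κ.symm.toLinearMap
  have hC : Function.Bijective C := by
    constructor
    · intro φ ψ h
      refine LinearMap.ext fun x => ?_
      obtain ⟨y, rfl⟩ := κ.symm.surjective x
      exact LinearMap.congr_fun h y
    · intro ψ
      refine ⟨ψ ∘ₗ κ.toLinearMap, LinearMap.ext fun y => ?_⟩
      exact congrArg ψ (κ.apply_symm_apply y)
  have h1 : ⇑(evalMap A (transpose R M)) = C ∘ transposeToDual R M := by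
    refine funext fun z => LinearMap.ext fun y => ?_
    obtain ⟨x, rfl⟩ := κ.surjective y
    refine Eq.trans ?_ (congrArg (show syz R (syz R M) →ₗ[Aᵐᵒᵖ] A from transposeToDual R M z)
      (κ.symm_apply_apply x).symm)
    rfl
  rw [IsReflexive, h1, hC.of_comp_iff']

/-- Any isomorphism `Tr M ≅ (Ω² M)^*` is the restriction map up to an endomorphism of
`(Ω² M)^*`, which is surjective, hence bijective. -/
lemma bijective_transposeToDual_of_equiv (θ : transpose R M ≃ₗ[A] dual R (syz R (syz R M))) :
    Function.Bijective (transposeToDual R M) := by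
  have := isNoetherianRing_of_finite R A
  let κ := LinearEquiv.ofBijective _ (bijective_flipDual_transposeToDual (R := R) M)
  let T : syz R (syz R M) →ₗ[Aᵐᵒᵖ] syz R (syz R M) := κ.symm.toLinearMap ∘ₗ flipDual θ.toLinearMap
  have hT : ∀ z, dualMap R T (transposeToDual R M z) = θ z := fun z =>
    LinearMap.ext fun x => LinearMap.congr_fun (κ.apply_symm_apply (flipDual θ.toLinearMap x)) z
  have hs : Function.Surjective (dualMap R T) := fun y => by
    obtain ⟨z, rfl⟩ := θ.surjective y
    exact ⟨_, hT z⟩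
  have hi := IsNoetherian.injective_of_surjective_endomorphism _ hs
  refine (Function.Bijective.of_comp_iff' ⟨hi, hs⟩ _).1 ?_
  rw [show ⇑(dualMap R T) ∘ transposeToDual R M = θ from funext hT]
  exact θ.bijective

end Reflexive

/-! ### The theorem in dimension zero and in positive dimension -/

section Final

variable {R : Type u} [CommRing R] [IsLocalRing R] [IsNoetherianRing R]
  {A : Type u} [Ring A] [Algebra R A] [Module.Finite R A]

/-- In dimension zero, all three conditions say that the restriction map
`Tr X → (Ω² X)^*` is bijective. -/
lemma tfae_of_ringKrullDim_eq_zero (hR : IsGorensteinLocal R) (hd : ringKrullDim R = 0)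
    (X : FGModuleCat.{u} Aᵐᵒᵖ) :
    List.TFAE [
      Subsingleton (Abelian.Ext X.obj (ModuleCat.of Aᵐᵒᵖ A) 1) ∧
        Subsingleton (Abelian.Ext X.obj (ModuleCat.of Aᵐᵒᵖ A) 2),
      IsReflexive A (Trd R 0 X),
      Nonempty (tau R 0 X ≅ nakayama R (syzPow R 2 X))] := by
  tfae_have 1 ↔ 2 := by
    rw [subsingleton_ext_iff (R := R) A X 0, subsingleton_ext_iff (R := R) A X 1]
    exact (and_congr transposeToDual_injective_iff transposeToDual_surjective_iff).symm.trans
      (isReflexive_transpose_iff X).symm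
  tfae_have 2 → 3 := fun h =>
    nonempty_Dd_iso (LinearEquiv.ofBijective _ ((isReflexive_transpose_iff X).1 h))
  tfae_have 3 → 2 := fun h => by
    obtain ⟨θ⟩ := nonempty_equiv_of_Dd_iso hR hd h
    exact (isReflexive_transpose_iff X).2 (bijective_transposeToDual_of_equiv X θ)
  tfae_finish

/-- In positive dimension, all three conditions hold. -/
lemma tfae_of_ringKrullDim_pos [IsAdicComplete (IsLocalRing.maximalIdeal R) R] {d : ℕ}
    (hd : ringKrullDim R = d) (h0 : 0 < d) (hA : IsCohenMacaulay R A)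
    (hper : IsPeriodic R A (2 * d)) {X : FGModuleCat.{u} Aᵐᵒᵖ} (hX : IsCMObj R X) :
    List.TFAE [
      Subsingleton (Abelian.Ext X.obj (ModuleCat.of Aᵐᵒᵖ A) (d + 1)) ∧
        Subsingleton (Abelian.Ext X.obj (ModuleCat.of Aᵐᵒᵖ A) (d + 2)),
      IsReflexive A (Trd R d X),
      Nonempty (tau R d X ≅ nakayama R (syzPow R (d + 2) X))] := by
  obtain ⟨η⟩ := hper
  have hA' := isCMObj_right_regular hd hA
  have hext : ∀ n, SyzygyMapsExtend R Aᵐᵒᵖ (syzPow R n X) := fun n =>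
    syzygyMapsExtend_of_periodic η hd (by omega) hA' (IsCMObj.syzPow (B := Aᵐᵒᵖ) hd hA' hX n)
  obtain ⟨hrefl, ⟨e⟩⟩ := nonempty_Trd_equiv hext h0 (stablyIso_syzPow η hX)
  have h1 : Subsingleton (Abelian.Ext X.obj (ModuleCat.of Aᵐᵒᵖ A) (d + 1)) ∧
      Subsingleton (Abelian.Ext X.obj (ModuleCat.of Aᵐᵒᵖ A) (d + 2)) :=
    ⟨(subsingleton_ext_iff (R := R) A X d).2 ((hext d).congr (opLinearEquivSelf A).symm),
      (subsingleton_ext_iff (R := R) A X (d + 1)).2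
        ((hext (d + 1)).congr (opLinearEquivSelf A).symm)⟩
  have h2 : IsReflexive A (Trd R d X) := hrefl.isReflexive e
  have h3 : Nonempty (tau R d X ≅ nakayama R (syzPow R (d + 2) X)) := nonempty_Dd_iso e
  tfae_have 1 → 2 := fun _ => h2
  tfae_have 2 → 3 := fun _ => h3
  tfae_have 3 → 1 := fun _ => h1
  tfae_finish

end Final
end CMOrder

end

theorem mainTheorem1 (R : Type u) [CommRing R] [IsLocalRing R] [IsNoetherianRing R]
    [IsAdicComplete (IsLocalRing.maximalIdeal R) R] (hR : CMOrder.IsGorensteinLocal R)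
    (d : ℕ) (hd : ringKrullDim R = d)
    (A : Type u) [Ring A] [Algebra R A] [Module.Finite R A]
    (hA : CMOrder.IsIsolatedSingularity R A) (hper : CMOrder.IsPeriodic R A (2 * d))
    (X : FGModuleCat.{u} Aᵐᵒᵖ) (hX : CMOrder.IsCMObj R X)
    (hind : CMOrder.IsIndecomposable Aᵐᵒᵖ X) (hproj : ¬ Module.Projective Aᵐᵒᵖ X) :
    List.TFAE [
      Subsingleton (CategoryTheory.Abelian.Ext X.obj (ModuleCat.of Aᵐᵒᵖ A) (d + 1)) ∧
        Subsingleton (CategoryTheory.Abelian.Ext X.obj (ModuleCat.of Aᵐᵒᵖ A) (d + 2)),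
      CMOrder.IsReflexive A (CMOrder.Trd R d X),
      Nonempty (CMOrder.tau R d X ≅ CMOrder.nakayama R (CMOrder.syzPow R (d + 2) X))] := by
  obtain rfl | h0 := Nat.eq_zero_or_pos d
  · exact CMOrder.tfae_of_ringKrullDim_eq_zero hR hd X
  · exact CMOrder.tfae_of_ringKrullDim_pos hd h0 hA.isOrder hper hX
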